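/- Let $\Omega\subset\mathbb R^2$ be a polygonal domain (a bounded domain bounded by a simple closed polygon) with at most one interior angle greater than $\pi/2$. Let $\omega\in(0,2\pi)$ be its largest interior angle, attained at a vertex placed at the origin, and let $(r,\theta)$ be polar coordinates such that, for some $R>0$, $\Omega\cap\{r<R\}=\{0<r<R,\ 0<\theta<\omega\}$. Let $N\ge 0$ be the largest integer with $N<2\omega/\pi$, let $\tau\in(0,1)$, and let $\eta=\eta(r)$ be a $C^\infty$ cut-off function with $\eta=1$ for $0\le r\le\tau R$ and $\eta=0$ for $r>R$. For $1\le i\le N$ put $$\chi_i=\eta(r)\,r^{-i\pi/\omega}\sin\Bigl(\frac{i\pi}{\omega}\theta\Bigr).$$ For a conforming triangulation $\mathcal T_n$ of $\Omega$ let $S_n\subset H^1_0(\Omega)$ be the space of continuous functions that are affine on each triangle of $\mathcal T_n$ and vanish on $\partial\Omega$, and let $A(\phi,\psi)=\int_\Omega\nabla\phi\cdot\nabla\psi\,dx$. Write $(g,\phi)=\langle \phi,g\rangle=\int_\Omega g\phi\,dx$. Let $\zeta_{i,n}\in S_n$ satisfy $A(\zeta_{i,n},\phi)=(\Delta\chi_i,\phi)$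 for all $\phi\in S_n$, put $\xi_{i,n}=\zeta_{i,n}+\chi_i$, and let $\sigma_{i,n}\in S_n$ satisfy $A(\sigma_{i,n},\phi)=(\xi_{i,n},\phi)$ for all $\phi\in S_n$ $(1\le i\le N)$. (a) For every triangulation $\mathcal T_n$, the functions $\xi_{1,n},\dots,\xi_{N,n}$ belong to $H^{-1}(\Omega)$ and are linearly independent there. (b) For every $\kappa$ there is $h_0>0$ (depending only on $\kappa$, $\Omega$, $\tau$, $R$, $\eta$ and the choice of coordinates) such that the following holds for every triangulation $\mathcal T_n$ of mesh size at most $h_0$ that is shape-regular with constant $\kappa$ (each triangle $T$ contains a disc of some radius $\rho>0$ with $\operatorname{diam}T\le\kappa\rho$). The functions $\sigma_{1,n},\dots,\sigma_{N,n}$ are linearly independent in $H^1_0(\Omega)$, and their gradients $\nabla\sigma_{1,n},\dots,\nabla\sigma_{N,n}$ are linearly independent in $L^2(\Omega)^2$. Consequently, for every $v_n\in S_n$ the linear system $$\sum_{i=1}^N c_{i,n}\langle\sigma_{i,n},\xi_{j,n}\rangle=\langle v_n,\xi_{j,n}\rangle,\qquad j=1,\dots,N,$$ has a unique solution $(c_{1,n},\dots,c_{N,n})\in\mathbb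 R^N$. -/

import Mathlib

open MeasureTheory Set

noncomputable section

/-! ### Polygonal domains (the plane `ℝ²` is identified with `ℂ`) -/

/-- The open sector with apex `p`, radius `ρ` and opening `ω`, whose first side has direction
`α`. -/
def sector (p : ℂ) (α ω ρ : ℝ) : Set ℂ :=
  {z | ∃ r θ : ℝ, 0 < r ∧ r < ρ ∧ 0 < θ ∧ θ < ω ∧
    z = p + r * Complex.exp (((α + θ : ℝ) : ℂ) * Complex.I)}

/-- `Ω` has the interior angle `ω ∈ (0, 2π)` at the boundary point `p`: near `p`, it is a sector
of opening `ω`. -/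
def HasInteriorAngle (Ω : Set ℂ) (p : ℂ) (ω : ℝ) : Prop :=
  0 < ω ∧ ω < 2 * Real.pi ∧
    ∃ α ρ : ℝ, 0 < ρ ∧ Ω ∩ Metric.ball p ρ = sector p α ω ρ

/-- `Ω` is a polygonal domain with the vertices `p 0, …, p (m + 2)`: a bounded domain whose
boundary is the simple closed polygon with these consecutive vertices (the indices are cyclic). -/
structure IsPolygonalDomain {m : ℕ} (Ω : Set ℂ) (p : Fin (m + 3) → ℂ) : Prop where
  isOpen : IsOpen Ω
  isConnected : IsConnected Ω
  isBounded : Bornology.IsBounded Ω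
  injective : Function.Injective p
  simple : ∀ j k, j ≠ k →
    segment ℝ (p j) (p (j + 1)) ∩ segment ℝ (p k) (p (k + 1)) ⊆
      ({p j, p (j + 1)} : Set ℂ) ∩ {p k, p (k + 1)}
  frontier_eq : frontier Ω = ⋃ k, segment ℝ (p k) (p (k + 1))

/-- The domains under consideration: polygonal domains, one vertex `p 0` of which is the origin
and has the interior angle `ω`; this is the largest interior angle, and the only one that may
exceed `π / 2`. -/
structure IsCornerDomain {m : ℕ} (Ω : Set ℂ) (p : Fin (m + 3) → ℂ) (ω : ℝ) : Prop where
  polygonal : IsPolygonalDomain Ω p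
  corner_eq : p 0 = 0
  corner_angle : HasInteriorAngle Ω 0 ω
  other_angle : ∀ k, k ≠ 0 → ∀ β, HasInteriorAngle Ω (p k) β → β ≤ ω ∧ β ≤ Real.pi / 2

/-! ### The spaces `H¹₀(Ω)` and `H⁻¹(Ω)` -/

/-- `L²(Ω; ℝ) × L²(Ω; ℝ²)` with the Hilbert space norm; `H¹₀(Ω)` is embedded in it by
`u ↦ (u, ∇u)`. -/
abbrev L2Pair (Ω : Set ℂ) : Type :=
  WithLp 2 (Lp ℝ 2 (volume.restrict Ω) × Lp ℂ 2 (volume.restrict Ω))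

/-- The pairs `(φ, ∇φ)` with a test function `φ ∈ C_c^∞(Ω)`. -/
def testPairs (Ω : Set ℂ) : Set (L2Pair Ω) :=
  {u | ∃ φ : ℂ → ℝ, ContDiff ℝ (⊤ : ℕ∞) φ ∧ HasCompactSupport φ ∧ tsupport φ ⊆ Ω ∧
    u.fst =ᵐ[volume.restrict Ω] φ ∧ u.snd =ᵐ[volume.restrict Ω] gradient φ}

/-- `H¹₀(Ω)`, the closure of `C_c^∞(Ω)` in the norm `(‖u‖² + ‖∇u‖²)^{1/2}`. An element is
stored as the pair of `u` and its weak gradient `∇u`. -/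
def H01 (Ω : Set ℂ) : Submodule ℝ (L2Pair Ω) :=
  (Submodule.span ℝ (testPairs Ω)).topologicalClosure

/-- The function `u ∈ L²(Ω)` underlying `u ∈ H¹₀(Ω)`. -/
def H01.val {Ω : Set ℂ} (u : H01 Ω) : Lp ℝ 2 (volume.restrict Ω) := (u : L2Pair Ω).fst

/-- The weak gradient of `u ∈ H¹₀(Ω)`. -/
def H01.grad {Ω : Set ℂ} (u : H01 Ω) : Lp ℂ 2 (volume.restrict Ω) := (u : L2Pair Ω).snd

/-- `H⁻¹(Ω)`, the dual space of `H¹₀(Ω)`. -/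
abbrev Hneg1 (Ω : Set ℂ) : Type := StrongDual ℝ (H01 Ω)

/-- The duality pairing `⟨u, g⟩ = (g, u) = ∫_Ω g u dx` of a function `g` on `Ω` with
`u ∈ H¹₀(Ω)`. -/
def pairing {Ω : Set ℂ} (g : ℂ → ℝ) (u : H01 Ω) : ℝ := ∫ z in Ω, g z * H01.val u z

/-- The function `g` on `Ω` belongs to `H⁻¹(Ω)`, as the functional `T`. -/
def RepresentsHneg1 {Ω : Set ℂ} (g : ℂ → ℝ) (T : Hneg1 Ω) : Prop :=
  ∀ u : H01 Ω, Integrable (fun z => g z * H01.val u z) (volume.restrict Ω) ∧ T u = pairing g u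

/-- The bilinear form `A(u, v) = ∫_Ω ∇u · ∇v dx`. -/
def dirichletForm {Ω : Set ℂ} (u v : H01 Ω) : ℝ :=
  ∫ z in Ω, inner ℝ (H01.grad u z) (H01.grad v z)

/-! ### The singular functions -/

/-- The number `N` of singular functions: the largest integer with `N < 2ω/π`. -/
def numSing (ω : ℝ) : ℕ := ⌈2 * ω / Real.pi⌉₊ - 1

/-- The polar angle in `[0, 2π)`. -/
def polarAngle (z : ℂ) : ℝ := toIcoMod Real.two_pi_pos 0 (Complex.arg z)

/-- `η` is a smooth cut-off function of the radius: `η = 1` on `[0, τR]`, and `η = 0` on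
`(R, ∞)`. -/
structure IsCutoff (η : ℝ → ℝ) (τ R : ℝ) : Prop where
  smooth : ContDiff ℝ (⊤ : ℕ∞) η
  eq_one : ∀ r, 0 ≤ r → r ≤ τ * R → η r = 1
  eq_zero : ∀ r, R < r → η r = 0

/-- The function `χ_k = η(r) r^{-kπ/ω} sin(kπθ/ω)`, in polar coordinates at the origin. -/
def chi (ω : ℝ) (η : ℝ → ℝ) (k : ℕ) (z : ℂ) : ℝ :=
  η ‖z‖ * ‖z‖ ^ (-(k * Real.pi / ω)) * Real.sin (k * Real.pi / ω * polarAngle z)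

/-! ### Finite elements -/

/-- `K` is a (conforming) triangulation of `Ω`: a finite simplicial complex that fills the closure
of `Ω`. -/
structure IsTriangulation (Ω : Set ℂ) (K : Geometry.SimplicialComplex ℝ ℂ) : Prop where
  finite : K.faces.Finite
  space_eq : K.space = closure Ω

/-- All triangles of `K` are shape-regular with constant `κ`: each triangle contains a disc of
some radius `ρ` such that the diameter of the triangle is at most `κρ`. -/
def ShapeRegular (K : Geometry.SimplicialComplex ℝ ℂ) (κ : ℝ) : Prop :=
  ∀ s ∈ K.faces, s.card = 3 → ∃ (c : ℂ) (ρ : ℝ), 0 < ρ ∧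
    Metric.ball c ρ ⊆ convexHull ℝ (s : Set ℂ) ∧
    Metric.diam (convexHull ℝ (s : Set ℂ)) ≤ κ * ρ

/-- The mesh size of `K` is at most `h`. -/
def MeshSizeLE (K : Geometry.SimplicialComplex ℝ ℂ) (h : ℝ) : Prop :=
  ∀ s ∈ K.faces, s.card = 3 → Metric.diam (convexHull ℝ (s : Set ℂ)) ≤ h

/-- `f` is a continuous function on the closure of `Ω` that vanishes on the boundary and is affine
on each triangle of `K`. -/
structure IsLagrangeP1 (Ω : Set ℂ) (K : Geometry.SimplicialComplex ℝ ℂ) (f : ℂ → ℝ) : Prop where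
  continuousOn : ContinuousOn f (closure Ω)
  boundary : ∀ z ∈ frontier Ω, f z = 0
  affine : ∀ s ∈ K.faces, s.card = 3 →
    ∃ g : ℂ →ᵃ[ℝ] ℝ, EqOn f g (convexHull ℝ (s : Set ℂ))

/-- The `C⁰` Lagrange linear finite element space `S ⊂ H¹₀(Ω)` of the triangulation `K`. -/
def feSpace (Ω : Set ℂ) (K : Geometry.SimplicialComplex ℝ ℂ) : Submodule ℝ (H01 Ω) where
  carrier := {u | ∃ f : ℂ → ℝ, IsLagrangeP1 Ω K f ∧ H01.val u =ᵐ[volume.restrict Ω] f}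
  zero_mem' := ⟨0, ⟨continuousOn_const, fun _ _ => rfl, fun _ _ _ => ⟨0, fun _ _ => rfl⟩⟩,
    Lp.coeFn_zero ℝ 2 _⟩
  add_mem' := by
    rintro u v ⟨f, hf, huf⟩ ⟨g, hg, hvg⟩
    refine ⟨f + g, ⟨hf.continuousOn.add hg.continuousOn, fun z hz => ?_, fun s hs hc => ?_⟩, ?_⟩
    · simp [hf.boundary z hz, hg.boundary z hz]
    · obtain ⟨a, ha⟩ := hf.affine s hs hc
      obtain ⟨b, hb⟩ := hg.affine s hs hc
      exact ⟨a + b, fun z hz => by simp [ha hz, hb hz]⟩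
    · exact (Lp.coeFn_add (H01.val u) (H01.val v)).trans (huf.add hvg)
  smul_mem' := by
    rintro c u ⟨f, hf, huf⟩
    refine ⟨c • f, ⟨hf.continuousOn.const_smul c, fun z hz => ?_, fun s hs hc => ?_⟩, ?_⟩
    · simp [hf.boundary z hz]
    · obtain ⟨a, ha⟩ := hf.affine s hs hc
      exact ⟨c • a, fun z hz => by simp [ha hz]⟩
    · exact (Lp.coeFn_smul c (H01.val u)).trans (huf.const_smul c)

/-- `z` is the finite element solution in `feSpace Ω K` of `-Δz = g` in `Ω`, `z = 0` on `∂Ω`. -/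
def IsFESolution {Ω : Set ℂ} (K : Geometry.SimplicialComplex ℝ ℂ) (g : ℂ → ℝ) (z : H01 Ω) :
    Prop :=
  z ∈ feSpace Ω K ∧ ∀ φ ∈ feSpace Ω K, dirichletForm z φ = pairing g φ

/-- The functions `ζ_1, …, ζ_N` are the finite element solutions with right-hand sides
`Δχ_1, …, Δχ_N` (the index `i : Fin N` stands for `i + 1`). -/
def IsZeta {Ω : Set ℂ} (K : Geometry.SimplicialComplex ℝ ℂ) (ω : ℝ) (η : ℝ → ℝ)
    (ζ : Fin (numSing ω) → H01 Ω) : Prop :=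
  ∀ i : Fin (numSing ω), IsFESolution K (Laplacian.laplacian (chi ω η ((i : ℕ) + 1))) (ζ i)

/-- The discrete functions `ξ_i = ζ_i + χ_i`. -/
def discreteXi {Ω : Set ℂ} (ω : ℝ) (η : ℝ → ℝ) (ζ : Fin (numSing ω) → H01 Ω)
    (i : Fin (numSing ω)) (z : ℂ) : ℝ :=
  H01.val (ζ i) z + chi ω η ((i : ℕ) + 1) z

end

/-! Write `s_i = iπ/ω`, `X_c = ∑ c_i χ_i` and `Z_c = ∑ c_i ζ_i`. The key is that no nontrivial `X_c`
acts on test functions like an element of `L⁴(Ω)`, whereas every `Z_c` does, because `H¹₀(Ω)` embeds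
in `L⁴(Ω)` in the plane. The first fact (`IsSectorNearZero.eq_zero_of_bound`) is a scaling argument.
For `φ_ε(z) = b(z/ε)` with a bump `b` near the corner, the pairing with `χ_i` is `ε^(2 - s_i)` times
a constant, while the `L^(4/3)` norm is of order `ε^(3/2)`. Since `ω < 2π`, all `s_i` exceed `1/2`,
so a bound by the `L^(4/3)` norm kills the coefficient of largest index.

For (a), the bound `s_i < 2` puts every `χ_i` in some `L^p` with `p > 1`, hence in `H⁻¹`. If `∑ c_i
ξ_i = 0`, then `X_c` acts as `-Z_c`, so `c = 0`.

For (b), a relation `∑ c_i ∇σ_i = 0` says that `∑ c_i ξ_i` annihilates the finite element space.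
`IsSectorNearZero.exists_mesh_size` excludes this on fine meshes by compactness. Take normalized bad
coefficients on meshes with size tending to zero, and let `a` be a limit of a subsequence. The
gradients of `ζ_i` are bounded uniformly in the mesh, since the functions `Δχ_i` are bounded. Each
test function is uniformly close to a finite element function (`exists_interpolant`), and `X_c +
Z_c` is bounded in `L¹`. In the limit `X_a` obeys the `L^(4/3)` bound, so `a = 0`, against the
normalization. Finally, the matrix of the linear system is the Gram matrix of the gradients `∇σ_i`.
-/

noncomputable section

open scoped NNReal ENNReal Topology Convolution

/-! ### Test functions as elements of `H¹₀(Ω)`. -/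

/-- Test functions on `Ω`. -/
structure IsTest (Ω : Set ℂ) (φ : ℂ → ℝ) : Prop where
  smooth : ContDiff ℝ (⊤ : ℕ∞) φ
  compact : HasCompactSupport φ
  subset : tsupport φ ⊆ Ω

lemma gradient_eq_zero_of_notMem_tsupport {φ : ℂ → ℝ} {z : ℂ} (h : z ∉ tsupport φ) :
    gradient φ z = 0 := by
  simp [gradient, fderiv_of_notMem_tsupport (𝕜 := ℝ) h]

namespace IsTest

variable {Ω : Set ℂ} {φ ψ : ℂ → ℝ}

lemma eq_zero (h : IsTest Ω φ) {z : ℂ} (hz : z ∉ Ω) : φ z = 0 :=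
  image_eq_zero_of_notMem_tsupport fun hz' => hz (h.subset hz')

lemma continuous_gradient (h : IsTest Ω φ) : Continuous (gradient φ) :=
  (InnerProductSpace.toDual ℝ ℂ).symm.continuous.comp (h.smooth.continuous_fderiv (by simp))

lemma hasCompactSupport_gradient (h : IsTest Ω φ) : HasCompactSupport (gradient φ) :=
  (h.compact.fderiv (𝕜 := ℝ)).comp_left (g := (InnerProductSpace.toDual ℝ ℂ).symm) (map_zero _)

lemma memLp (h : IsTest Ω φ) (p : ℝ≥0∞) (μ : Measure ℂ) [IsFiniteMeasureOnCompacts μ] :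
    MemLp φ p μ :=
  h.smooth.continuous.memLp_of_hasCompactSupport h.compact

lemma memLp_gradient (h : IsTest Ω φ) (p : ℝ≥0∞) (μ : Measure ℂ) [IsFiniteMeasureOnCompacts μ] :
    MemLp (gradient φ) p μ :=
  h.continuous_gradient.memLp_of_hasCompactSupport h.hasCompactSupport_gradient

lemma add (h : IsTest Ω φ) (h' : IsTest Ω ψ) : IsTest Ω (φ + ψ) :=
  ⟨h.smooth.add h'.smooth, h.compact.add h'.compact,
    (tsupport_add φ ψ).trans (union_subset h.subset h'.subset)⟩

lemma smul (c : ℝ) (h : IsTest Ω φ) : IsTest Ω (c • φ) :=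
  ⟨contDiff_const.smul h.smooth, h.compact.smul_left (f := fun _ => c),
    (tsupport_smul_subset_right (fun _ => c) φ).trans h.subset⟩

lemma differentiable (h : IsTest Ω φ) : Differentiable ℝ φ := h.smooth.differentiable (by simp)

/-- The pair `(φ, ∇φ)`. -/
def pair (h : IsTest Ω φ) : L2Pair Ω :=
  WithLp.toLp 2 ((h.memLp 2 (volume.restrict Ω)).toLp φ,
    (h.memLp_gradient 2 (volume.restrict Ω)).toLp (gradient φ))

lemma pair_mem (h : IsTest Ω φ) : h.pair ∈ testPairs Ω :=
  ⟨φ, h.smooth, h.compact, h.subset, (h.memLp 2 _).coeFn_toLp, (h.memLp_gradient 2 _).coeFn_toLp⟩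

/-- A test function as an element of `H¹₀(Ω)`. -/
def toH01 (h : IsTest Ω φ) : H01 Ω :=
  ⟨h.pair, Submodule.le_topologicalClosure _ (Submodule.subset_span h.pair_mem)⟩

lemma val_toH01 (h : IsTest Ω φ) : H01.val h.toH01 =ᵐ[volume.restrict Ω] φ :=
  (h.memLp 2 _).coeFn_toLp

lemma grad_toH01 (h : IsTest Ω φ) : H01.grad h.toH01 =ᵐ[volume.restrict Ω] gradient φ :=
  (h.memLp_gradient 2 _).coeFn_toLp

end IsTest

lemma gradient_add' {φ ψ : ℂ → ℝ} (h : Differentiable ℝ φ) (h' : Differentiable ℝ ψ) :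
    gradient (φ + ψ) = gradient φ + gradient ψ := by
  ext1 z
  simp [gradient, fderiv_add (h z) (h' z)]

lemma gradient_smul' {φ : ℂ → ℝ} (h : Differentiable ℝ φ) (c : ℝ) :
    gradient (c • φ) = c • gradient φ := by
  ext1 z
  simp [gradient, fderiv_const_smul (h z) c]

/-- Test pairs already form a subspace, so elements of `H¹₀(Ω)` are limits of single test pairs and
not merely of combinations. -/
lemma span_testPairs {Ω : Set ℂ} {u : L2Pair Ω} (hu : u ∈ Submodule.span ℝ (testPairs Ω)) :
    u ∈ testPairs Ω := by
  induction hu using Submodule.span_induction with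
  | mem x h => exact h
  | zero =>
    refine ⟨0, contDiff_const, HasCompactSupport.zero, by simp [tsupport], Lp.coeFn_zero ℝ 2 _, ?_⟩
    have : gradient (0 : ℂ → ℝ) = 0 := by ext1 z; simp [gradient]
    rw [this]; exact Lp.coeFn_zero ℂ 2 _
  | add x y _ _ hx hy =>
    obtain ⟨φ, a, b, c, d, e⟩ := hx
    obtain ⟨ψ, a', b', c', d', e'⟩ := hy
    have hφ : IsTest Ω φ := ⟨a, b, c⟩
    have hψ : IsTest Ω ψ := ⟨a', b', c'⟩
    have := hφ.add hψ
    refine ⟨φ + ψ, this.1, this.2, this.3, ?_, ?_⟩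
    · exact (Lp.coeFn_add x.fst y.fst).trans (d.add d')
    · rw [gradient_add' hφ.differentiable hψ.differentiable]
      exact (Lp.coeFn_add x.snd y.snd).trans (e.add e')
  | smul t x _ hx =>
    obtain ⟨φ, a, b, c, d, e⟩ := hx
    have hφ : IsTest Ω φ := ⟨a, b, c⟩
    have := hφ.smul t
    refine ⟨t • φ, this.1, this.2, this.3, ?_, ?_⟩
    · exact (Lp.coeFn_smul t x.fst).trans (d.const_smul t)
    · rw [gradient_smul' hφ.differentiable]
      exact (Lp.coeFn_smul t x.snd).trans (e.const_smul t)

/-- Elements of `H¹₀(Ω)` are limits of test functions. -/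
lemma H01.exists_seq {Ω : Set ℂ} (u : H01 Ω) :
    ∃ v : ℕ → L2Pair Ω, (∀ n, v n ∈ testPairs Ω) ∧
      Filter.Tendsto v Filter.atTop (𝓝 (u : L2Pair Ω)) := by
  have : (u : L2Pair Ω) ∈ closure (Submodule.span ℝ (testPairs Ω) : Set (L2Pair Ω)) := u.2
  obtain ⟨v, hv, hl⟩ := mem_closure_iff_seq_limit.1 this
  exact ⟨v, fun n => span_testPairs (hv n), hl⟩

/-! ### Sobolev inequalities and pairings with `H¹₀(Ω)`. -/

/-- The exponent 2 is borderline in the plane, so the Gagliardo–Nirenberg–Sobolev inequality is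
applied with a gradient exponent `p < 2`; boundedness of `Ω` then allows passing from `L^p` to `L²`.
-/
lemma sobolev_test {Ω : Set ℂ} (hΩ : Bornology.IsBounded Ω) {q : ℝ≥0} (hq : 0 < q) :
    ∃ C : ℝ≥0, ∀ φ, IsTest Ω φ → eLpNorm φ q (volume.restrict Ω) ≤
      C * eLpNorm (gradient φ) 2 (volume.restrict Ω) := by
  obtain ⟨p, hp1, hp2, hpq⟩ : ∃ p : ℝ≥0, 1 ≤ p ∧ p < 2 ∧ (p : ℝ)⁻¹ - (2 : ℝ)⁻¹ ≤ (q : ℝ)⁻¹ := by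
    rcases le_or_gt q 2 with h | h
    · refine ⟨1, le_rfl, by norm_num, ?_⟩
      have : (2 : ℝ)⁻¹ ≤ (q : ℝ)⁻¹ := inv_anti₀ (by exact_mod_cast hq) (by exact_mod_cast h)
      norm_num at this ⊢
      exact this
    · have hq' : (0 : ℝ) < q := by exact_mod_cast hq
      have h' : (2 : ℝ) < q := by exact_mod_cast h
      refine ⟨2 * q / (q + 2), ?_, ?_, ?_⟩
      · rw [← NNReal.coe_le_coe]; push_cast
        rw [le_div_iff₀ (by positivity)]; linarith
      · rw [← NNReal.coe_lt_coe]; push_cast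
        rw [div_lt_iff₀ (by positivity)]; linarith
      · push_cast
        apply le_of_eq
        field_simp
        ring
  have hfin : volume Ω < ∞ := hΩ.measure_lt_top
  have : IsFiniteMeasure (volume.restrict Ω) := ⟨by simpa using hfin⟩
  set K : ℝ≥0∞ := volume.restrict Ω univ ^ (1 / (p : ℝ≥0∞).toReal - 1 / (2 : ℝ≥0∞).toReal) with hK
  have hKt : K ≠ ∞ := by
    refine ENNReal.rpow_ne_top_of_nonneg ?_ (measure_ne_top _ _)
    have : (0 : ℝ) < p := lt_of_lt_of_le one_pos (by exact_mod_cast hp1)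
    have hp2' : (p : ℝ) < 2 := by exact_mod_cast hp2
    simp only [ENNReal.coe_toReal, ENNReal.toReal_ofNat, sub_nonneg]
    gcongr
  refine ⟨eLpNormLESNormFDerivOfLeConst ℝ (volume : Measure ℂ) Ω p q * K.toNNReal, fun φ hφ => ?_⟩
  have h1 := eLpNorm_le_eLpNorm_fderiv_of_le (μ := (volume : Measure ℂ)) (u := φ) (s := Ω)
    (hφ.smooth.of_le (by simp)) ((subset_tsupport φ).trans hφ.subset) hp1
    (by simpa using hp2) (by simpa using hpq) hΩ
  have h2 : eLpNorm (fderiv ℝ φ) p volume = eLpNorm (gradient φ) p (volume.restrict Ω) := by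
    rw [← eLpNorm_norm (fderiv ℝ φ), ← eLpNorm_norm (gradient φ),
      eLpNorm_restrict_eq_of_support_subset]
    · congr 1
      ext1 z
      simp [gradient]
    · intro z hz
      by_contra hz'
      exact hz (by simp [gradient_eq_zero_of_notMem_tsupport (fun h => hz' (hφ.subset h))])
  calc _ ≤ eLpNorm φ q volume := eLpNorm_mono_measure _ Measure.restrict_le_self
    _ ≤ _ := h1
    _ ≤ eLpNormLESNormFDerivOfLeConst ℝ (volume : Measure ℂ) Ω p q *
        (eLpNorm (gradient φ) 2 (volume.restrict Ω) * K) := by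
      rw [h2]
      gcongr
      exact eLpNorm_le_eLpNorm_mul_rpow_measure_univ (by exact_mod_cast hp2.le)
        (hφ.memLp_gradient 1 _).1
    _ = _ := by
      rw [ENNReal.coe_mul, ENNReal.coe_toNNReal hKt]; ring

/-- The Sobolev and Poincaré inequalities in `H¹₀(Ω)`. -/
lemma H01.sobolev {Ω : Set ℂ} (hΩ : Bornology.IsBounded Ω) {q : ℝ≥0} (hq : 0 < q) :
    ∃ C : ℝ≥0, ∀ u : H01 Ω, eLpNorm (H01.val u) q (volume.restrict Ω) ≤ C * ‖H01.grad u‖ₑ := by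
  obtain ⟨C, hC⟩ := sobolev_test hΩ hq
  refine ⟨C, fun u => ?_⟩
  obtain ⟨v, hv, hl⟩ := H01.exists_seq u
  have hfst : Filter.Tendsto (fun n => (v n).fst) Filter.atTop (𝓝 (H01.val u)) :=
    ((WithLp.prod_continuous_ofLp 2 _ _).fst.tendsto _).comp hl
  have hsnd : Filter.Tendsto (fun n => (v n).snd) Filter.atTop (𝓝 (H01.grad u)) :=
    ((WithLp.prod_continuous_ofLp 2 _ _).snd.tendsto _).comp hl
  -- Convergence is only known in `L²`; an almost everywhere convergent subsequence makes the `L^q`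
  -- norm lower semicontinuous by Fatou.
  obtain ⟨ns, hns, hae⟩ := (tendstoInMeasure_of_tendsto_Lp hfst).exists_seq_tendsto_ae
  have hb : ∀ n, eLpNorm (v n).fst q (volume.restrict Ω) ≤ C * ‖(v n).snd‖ₑ := by
    intro n
    obtain ⟨φ, a, b, c, d, e⟩ := hv n
    rw [eLpNorm_congr_ae d, Lp.enorm_def, eLpNorm_congr_ae e]
    exact hC φ ⟨a, b, c⟩
  have := Lp.eLpNorm_lim_le_liminf_eLpNorm (p := q) (fun n => Lp.aestronglyMeasurable (v (ns n)).fst)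
    _ hae
  refine this.trans ?_
  have ht : Filter.Tendsto (fun n => (C : ℝ≥0∞) * ‖(v (ns n)).snd‖ₑ) Filter.atTop
      (𝓝 (C * ‖H01.grad u‖ₑ)) :=
    ENNReal.Tendsto.const_mul ((hsnd.comp hns.tendsto_atTop).enorm) (by simp)
  rw [← ht.liminf_eq]
  exact Filter.liminf_le_liminf (Filter.Eventually.of_forall fun n => hb (ns n))

namespace H01

variable {Ω : Set ℂ}

lemma val_add (u v : H01 Ω) : val (u + v) = val u + val v := rfl
lemma val_smul (c : ℝ) (u : H01 Ω) : val (c • u) = c • val u := rfl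
lemma grad_add (u v : H01 Ω) : grad (u + v) = grad u + grad v := rfl
lemma grad_smul (c : ℝ) (u : H01 Ω) : grad (c • u) = c • grad u := rfl

lemma norm_grad_le (u : H01 Ω) : ‖grad u‖ ≤ ‖u‖ :=
  WithLp.norm_snd_le _ (u : L2Pair Ω)

/-- The weak gradient as a linear map. -/
def gradₗ (Ω : Set ℂ) : H01 Ω →ₗ[ℝ] Lp ℂ 2 (volume.restrict Ω) where
  toFun := grad
  map_add' := grad_add
  map_smul' := grad_smul

lemma memLp_val (hΩ : Bornology.IsBounded Ω) {q : ℝ≥0} (hq : 0 < q) (u : H01 Ω) :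
    MemLp (val u) q (volume.restrict Ω) := by
  obtain ⟨C, hC⟩ := sobolev hΩ hq
  exact ⟨Lp.aestronglyMeasurable _,
    (hC u).trans_lt (ENNReal.mul_lt_top (by simp) (by simp))⟩

end H01

lemma dirichletForm_eq_inner {Ω : Set ℂ} (u v : H01 Ω) :
    dirichletForm u v = inner ℝ (H01.grad u) (H01.grad v) := rfl

/-- The pairing of `L^p(Ω)` with `H¹₀(Ω)` is bounded by the norm of the gradient. -/
lemma pairing_bound {Ω : Set ℂ} (hΩ : Bornology.IsBounded Ω) {p q : ℝ≥0}
    (hpq : NNReal.HolderConjugate p q) :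
    ∃ C : ℝ, 0 ≤ C ∧ ∀ (g : ℂ → ℝ) (_ : MemLp g p (volume.restrict Ω)) (u : H01 Ω),
      Integrable (fun z => g z * H01.val u z) (volume.restrict Ω) ∧
      ∫ z in Ω, |g z * H01.val u z| ≤
        C * (eLpNorm g p (volume.restrict Ω)).toReal * ‖H01.grad u‖ := by
  obtain ⟨C, hC⟩ := H01.sobolev hΩ (q := q) hpq.symm.pos
  refine ⟨C, C.2, fun g hg u => ?_⟩
  have hu := H01.memLp_val hΩ hpq.symm.pos u
  have : ENNReal.HolderTriple p q 1 := by
    have := hpq.coe_ennreal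
    exact this
  have hint : Integrable (fun z => g z * H01.val u z) (volume.restrict Ω) := by
    have := hu.mul (r := 1) hg
    rwa [memLp_one_iff_integrable] at this
  refine ⟨hint, ?_⟩
  have h1 : ∫ z in Ω, |g z * H01.val u z| =
      (eLpNorm (fun z => g z * H01.val u z) 1 (volume.restrict Ω)).toReal := by
    rw [eLpNorm_one_eq_lintegral_enorm, ← integral_norm_eq_lintegral_enorm hint.1]
    rfl
  have h2 : eLpNorm (fun z => g z * H01.val u z) 1 (volume.restrict Ω) ≤
      eLpNorm g p (volume.restrict Ω) * eLpNorm (H01.val u) q (volume.restrict Ω) :=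
    eLpNorm_smul_le_mul_eLpNorm (φ := g) hu.1 hg.1
  rw [h1]
  calc _ ≤ (eLpNorm g p (volume.restrict Ω) * (C * ‖H01.grad u‖ₑ)).toReal := by
        refine ENNReal.toReal_mono ?_ (h2.trans (by gcongr; exact hC u))
        exact ENNReal.mul_ne_top hg.2.ne (ENNReal.mul_ne_top (by simp) (by simp))
    _ = _ := by
        simp [ENNReal.toReal_mul]; ring

/-- Functions of `L^p(Ω)`, `p > 1`, belong to `H⁻¹(Ω)`. -/
lemma exists_representsHneg1 {Ω : Set ℂ} (hΩ : Bornology.IsBounded Ω) {p : ℝ≥0} (hp : 1 < p)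
    {g : ℂ → ℝ} (hg : MemLp g p (volume.restrict Ω)) :
    ∃ T : Hneg1 Ω, RepresentsHneg1 g T := by
  obtain ⟨C, hC0, hC⟩ := pairing_bound hΩ (NNReal.HolderConjugate.conjExponent hp)
  have h := hC g hg
  let T : H01 Ω →ₗ[ℝ] ℝ :=
    { toFun := pairing g
      map_add' := fun u v => by
        rw [pairing, pairing, pairing, ← integral_add (h u).1 (h v).1]
        refine integral_congr_ae ?_
        filter_upwards [Lp.coeFn_add (H01.val u) (H01.val v)] with z hz
        rw [H01.val_add, hz, Pi.add_apply]; ring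
      map_smul' := fun c u => by
        rw [pairing, pairing, RingHom.id_apply, smul_eq_mul, ← integral_const_mul]
        refine integral_congr_ae ?_
        filter_upwards [Lp.coeFn_smul c (H01.val u)] with z hz
        rw [H01.val_smul, hz, Pi.smul_apply, smul_eq_mul]; ring }
  refine ⟨T.mkContinuous (C * (eLpNorm g p (volume.restrict Ω)).toReal) fun u => ?_,
    fun u => ⟨(h u).1, rfl⟩⟩
  refine (abs_integral_le_integral_abs.trans (h u).2).trans ?_
  gcongr
  exact H01.norm_grad_le u

/-! ### Lipschitz functions in `H¹₀(Ω)`. -/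

/-- A continuous function that is Lipschitz on each set of a finite closed cover is Lipschitz. -/
lemma lipschitzWith_of_finite_closed_cover {E ι : Type*} [NormedAddCommGroup E] [NormedSpace ℝ E]
    [Finite ι] {f : E → ℝ} (hf : Continuous f) {F : ι → Set E} (hF : ∀ i, IsClosed (F i))
    (hcov : ∀ z, ∃ i, z ∈ F i) {L : ℝ≥0} (hL : ∀ i, LipschitzOnWith L f (F i)) :
    LipschitzWith L f := by
  have key : ∀ x y, f y - f x ≤ L * ‖y - x‖ := by
    intro x y
    let p : ℝ → E := fun t => x + t • (y - x)
    have hp : Continuous p := by fun_prop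
    have := image_le_of_liminf_slope_right_le_deriv_boundary (f := fun t => f (p t) - f x)
      (B := fun t => L * ‖y - x‖ * t) (B' := fun _ => L * ‖y - x‖) (a := 0) (b := 1)
      (by fun_prop) (by simp [p]) (by fun_prop)
      (fun t _ => by simpa using (hasDerivWithinAt_id t (Ici t)).const_mul (L * ‖y - x‖)) ?_
      (right_mem_Icc.2 zero_le_one)
    · simpa [p] using this
    · intro t ht r hr
      -- Pigeonhole: one of the finitely many sets is met arbitrarily close to the right of `t`, and
      -- it contains `p t` because it is closed. A slope bound along such points is all that the
      -- mean value inequality requires.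
      obtain ⟨i, hi⟩ : ∃ i, ∃ᶠ z in 𝓝[>] t, p z ∈ F i := by
        by_contra h
        simp only [not_exists, Filter.not_frequently] at h
        obtain ⟨z, hz⟩ := (Filter.eventually_all.2 h).exists
        obtain ⟨i, hi⟩ := hcov (p z)
        exact hz i hi
      have hti : p t ∈ F i := (hF i).mem_of_frequently_of_tendsto hi
        (hp.continuousWithinAt (s := Ioi t) (x := t))
      refine (hi.and_eventually self_mem_nhdsWithin).mono fun z hz => ?_
      have htz : 0 < z - t := sub_pos.2 hz.2
      rw [slope_def_field, div_lt_iff₀ htz]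
      have h1 := (hL i).dist_le_mul _ hz.1 _ hti
      have h2 : dist (p z) (p t) = (z - t) * ‖y - x‖ := by
        rw [dist_eq_norm]
        have : p z - p t = (z - t) • (y - x) := by simp only [p]; module
        rw [this, norm_smul, Real.norm_of_nonneg htz.le]
      rw [h2, Real.dist_eq] at h1
      have := le_of_abs_le h1
      nlinarith
  refine LipschitzWith.of_dist_le_mul fun x y => ?_
  rw [Real.dist_eq, dist_eq_norm, abs_le]
  constructor
  · have := key x y
    rw [norm_sub_rev] at this; linarith
  · exact key y x

/-- The strong limit of a bounded sequence under a continuous linear map of Hilbert spaces lies in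
the range of the map. -/
lemma exists_preimage_of_bounded {H E : Type*} [NormedAddCommGroup H] [InnerProductSpace ℝ H]
    [CompleteSpace H] [NormedAddCommGroup E] [InnerProductSpace ℝ E] [CompleteSpace E]
    (P : H →L[ℝ] E) (u : ℕ → H) {M : ℝ} (hM : ∀ n, ‖u n‖ ≤ M) {f : E}
    (hf : Filter.Tendsto (fun n => P (u n)) Filter.atTop (𝓝 f)) : ∃ v, P v = f := by
  let T : ℕ → WeakDual ℝ H := fun n => StrongDual.toWeakDual (InnerProductSpace.toDual ℝ H (u n))
  let U : Ultrafilter ℕ := Filter.hyperfilter ℕ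
  have hU : (U : Filter ℕ) ≤ Filter.atTop := Nat.hyperfilter_le_atTop
  -- Banach–Alaoglu: a weak limit along an ultrafilter, carried back to `H` by the Riesz isometry,
  -- is the preimage sought.
  obtain ⟨S, -, hS⟩ := (WeakDual.isCompact_closedBall (𝕜 := ℝ) (E := H) 0 M).ultrafilter_le_nhds
    (U.map T) (by
      simp only [Ultrafilter.coe_map, Filter.le_principal_iff, Filter.mem_map]
      refine Filter.univ_mem' fun n => ?_
      simpa [T] using hM n)
  have hS' : Filter.Tendsto T U (𝓝 S) := hS
  refine ⟨(InnerProductSpace.toDual ℝ H).symm (WeakDual.toStrongDual S), ?_⟩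
  refine ext_inner_right ℝ fun w => ?_
  have h1 : Filter.Tendsto (fun n => T n (P.adjoint w)) U (𝓝 (S (P.adjoint w))) :=
    ((WeakDual.eval_continuous _).tendsto S).comp hS'
  have h2 : Filter.Tendsto (fun n => T n (P.adjoint w)) U (𝓝 (inner ℝ f w)) := by
    have : (fun n => T n (P.adjoint w)) = fun n => inner ℝ (P (u n)) w := by
      ext n
      simp [T, ContinuousLinearMap.adjoint_inner_right]
    rw [this]
    exact (hf.mono_left hU).inner tendsto_const_nhds
  rw [← ContinuousLinearMap.adjoint_inner_right, InnerProductSpace.toDual_symm_apply]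
  exact tendsto_nhds_unique h1 h2

/-- Averaging translates against a probability density keeps the Lipschitz constant. This bounds the
gradients of the mollifications uniformly. -/
lemma lipschitzWith_normed_convolution (b : ContDiffBump (0 : ℂ)) {f : ℂ → ℝ} {L : ℝ≥0}
    (hf : LipschitzWith L f) :
    LipschitzWith L (b.normed volume ⋆[ContinuousLinearMap.lsmul ℝ ℝ, volume] f) := by
  refine LipschitzWith.of_dist_le_mul fun x y => ?_
  have hex := b.hasCompactSupport_normed (μ := volume).convolutionExists_left
    (ContinuousLinearMap.lsmul ℝ ℝ) b.continuous_normed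
    (hf.continuous.locallyIntegrable (μ := volume))
  rw [Real.dist_eq, convolution_def, convolution_def, ← integral_sub (hex x) (hex y)]
  have : L * dist x y = ∫ t, b.normed volume t * (L * dist x y) := by
    rw [integral_mul_const, b.integral_normed, one_mul]
  have hint : Integrable (b.normed volume) := b.integrable_normed
  rw [this, ← Real.norm_eq_abs]
  refine norm_integral_le_of_norm_le (hint.mul_const _)
    (Filter.Eventually.of_forall fun t => ?_)
  simp only [ContinuousLinearMap.lsmul_apply, smul_eq_mul, ← mul_sub, norm_mul]
  rw [Real.norm_of_nonneg (b.nonneg_normed t)]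
  refine mul_le_mul_of_nonneg_left ?_ (b.nonneg_normed t)
  have := hf.dist_le_mul (x - t) (y - t)
  rwa [dist_sub_right, Real.dist_eq] at this

/-- Lipschitz functions with compact support in `Ω` belong to `H¹₀(Ω)`. -/
lemma exists_H01_of_lipschitz {Ω : Set ℂ} (hΩ : IsOpen Ω) (hb : Bornology.IsBounded Ω) {f : ℂ → ℝ}
    {L : ℝ≥0} (hf : LipschitzWith L f) (hc : HasCompactSupport f) (hs : tsupport f ⊆ Ω) :
    ∃ u : H01 Ω, H01.val u =ᵐ[volume.restrict Ω] f := by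
  have hfin : IsFiniteMeasure (volume.restrict Ω) := ⟨by simpa using hb.measure_lt_top⟩
  obtain ⟨δ, hδ, hδΩ⟩ := hc.isCompact.exists_cthickening_subset_open hΩ hs
  let r : ℕ → ℝ := fun n => δ / (n + 1)
  have hr : ∀ n, 0 < r n := fun n => by positivity
  have hrδ : ∀ n, r n ≤ δ := fun n => div_le_self hδ.le (by linarith [n.cast_nonneg (α := ℝ)])
  let b : ℕ → ContDiffBump (0 : ℂ) := fun n => ⟨r n / 2, r n, half_pos (hr n), half_lt_self (hr n)⟩
  let g : ℕ → ℂ → ℝ := fun n =>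
    (b n).normed volume ⋆[ContinuousLinearMap.lsmul ℝ ℝ, volume] f
  have hclose : ∀ n x, dist (g n x) (f x) ≤ L * r n := fun n x =>
    (b n).dist_normed_convolution_le hf.continuous.aestronglyMeasurable fun y hy =>
      (hf.dist_le_mul y x).trans (by gcongr; exact (Metric.mem_ball.1 hy).le)
  have hsupp : ∀ n, tsupport (g n) ⊆ Metric.cthickening δ (tsupport f) := by
    intro n
    refine closure_minimal (fun x hx => ?_) Metric.isClosed_cthickening
    by_contra hx'
    have hz : ∀ y ∈ Metric.ball x (r n), f y = 0 := by
      intro y hy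
      by_contra hy'
      refine hx' (Metric.mem_cthickening_of_dist_le x y δ _ (subset_tsupport f hy') ?_)
      rw [dist_comm]
      exact (Metric.mem_ball.1 hy).le.trans (hrδ n)
    have := (b n).dist_normed_convolution_le (μ := volume) (g := f) (x₀ := x) (ε := 0)
      hf.continuous.aestronglyMeasurable fun y hy => by
        rw [hz y hy, hz x (Metric.mem_ball_self (hr n)), dist_self]
    rw [dist_le_zero, hz x (Metric.mem_ball_self (hr n))] at this
    exact hx this
  have htest : ∀ n, IsTest Ω (g n) := fun n =>
    ⟨(b n).hasCompactSupport_normed.contDiff_convolution_left _ (b n).contDiff_normed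
        hf.continuous.locallyIntegrable,
      (hc.isCompact.cthickening).of_isClosed_subset (isClosed_tsupport _) (hsupp n),
      (hsupp n).trans hδΩ⟩
  have hmem : MemLp f 2 (volume.restrict Ω) := hf.continuous.memLp_of_hasCompactSupport hc
  let u : ℕ → H01 Ω := fun n => (htest n).toH01
  let P : H01 Ω →L[ℝ] Lp ℝ 2 (volume.restrict Ω) :=
    (WithLp.fstL 2 ℝ _ _).comp (H01 Ω).subtypeL
  have hlim : Filter.Tendsto (fun n => P (u n)) Filter.atTop (𝓝 (hmem.toLp f)) := by
    rw [tendsto_iff_norm_sub_tendsto_zero]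
    have hlim0 : Filter.Tendsto (fun n =>
        (measureUnivNNReal (volume.restrict Ω) : ℝ) ^ (2 : ℝ≥0∞).toReal⁻¹ * (L * r n))
        Filter.atTop (𝓝 0) := by
      have : Filter.Tendsto r Filter.atTop (𝓝 0) := by
        have := (tendsto_one_div_add_atTop_nhds_zero_nat (𝕜 := ℝ)).const_mul δ
        simpa [r, div_eq_mul_inv] using this
      simpa using (this.const_mul (L : ℝ)).const_mul
        ((measureUnivNNReal (volume.restrict Ω) : ℝ) ^ (2 : ℝ≥0∞).toReal⁻¹)
    refine squeeze_zero (fun _ => norm_nonneg _) (fun n => ?_) hlim0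
    refine Lp.norm_le_of_ae_bound (mul_nonneg L.2 (hr n).le) ?_
    filter_upwards [Lp.coeFn_sub (P (u n)) (hmem.toLp f), (htest n).val_toH01, hmem.coeFn_toLp]
      with z h1 h2 h3
    have h4 : P (u n) z = g n z := h2
    rw [h1, Pi.sub_apply, h4, h3]
    exact hclose n z
  have : CompleteSpace (H01 Ω) := (Submodule.isClosed_topologicalClosure _).completeSpace_coe
  -- The mollifications converge in `L²` but are only bounded in `H¹₀`, so weak compactness supplies
  -- the limit.
  obtain ⟨M, hM⟩ : ∃ M, ∀ n, ‖u n‖ ≤ M := by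
    obtain ⟨A, hA⟩ := (Metric.isBounded_range_of_tendsto _ hlim).exists_norm_le
    obtain ⟨B, hB⟩ : ∃ B, ∀ n, ‖H01.grad (u n)‖ ≤ B := by
      refine ⟨_, fun n => Lp.norm_le_of_ae_bound (C := L) L.2 ?_⟩
      filter_upwards [(htest n).grad_toH01] with z hz
      rw [hz, gradient, LinearIsometryEquiv.norm_map]
      exact norm_fderiv_le_of_lipschitz ℝ (lipschitzWith_normed_convolution (b n) hf)
    refine ⟨√(A ^ 2 + B ^ 2), fun n => Real.le_sqrt_of_sq_le ?_⟩
    have h1 : ‖u n‖ ^ 2 = ‖P (u n)‖ ^ 2 + ‖H01.grad (u n)‖ ^ 2 :=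
      WithLp.prod_norm_sq_eq_of_L2 (u n : L2Pair Ω)
    have h2 : ‖P (u n)‖ ≤ A := hA _ ⟨n, rfl⟩
    rw [h1]
    gcongr
    exact hB n
  obtain ⟨v, hv⟩ := exists_preimage_of_bounded P u hM hlim
  refine ⟨v, ?_⟩
  have : H01.val v = hmem.toLp f := hv
  rw [this]
  exact hmem.coeFn_toLp

/-! ### Triangulations and interpolation. -/

lemma exists_affineMap_eq {s : Finset ℂ} (hs : s.card = 3)
    (hi : AffineIndependent ℝ ((↑) : s → ℂ)) (φ : ℂ → ℝ) :
    ∃ g : ℂ →ᵃ[ℝ] ℝ, ∀ v ∈ s, g v = φ v := by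
  have htop : affineSpan ℝ (range ((↑) : s → ℂ)) = ⊤ := by
    rw [hi.affineSpan_eq_top_iff_card_eq_finrank_add_one]
    simp [hs]
  let b : AffineBasis s ℝ ℂ := ⟨(↑), hi, htop⟩
  refine ⟨∑ i : s, φ i • b.coord i, fun v hv => ?_⟩
  have h : ∀ i : s, b.coord i v = if i = ⟨v, hv⟩ then 1 else 0 := fun i => b.coord_apply i ⟨v, hv⟩
  let ev : (ℂ →ᵃ[ℝ] ℝ) →+ ℝ := ⟨⟨fun g => g v, rfl⟩, fun _ _ => rfl⟩
  have hev : ∀ g, g v = ev g := fun _ => rfl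
  rw [hev, map_sum]
  simp [ev, h]

lemma volume_convexHull_eq_zero {s : Finset ℂ} (hs : s.card ≠ 3)
    (hi : AffineIndependent ℝ ((↑) : s → ℂ)) : volume (convexHull ℝ (s : Set ℂ)) = 0 := by
  have htop : affineSpan ℝ (s : Set ℂ) ≠ ⊤ := by
    have := hi.affineSpan_eq_top_iff_card_eq_finrank_add_one
    simp only [Complex.finrank_real_complex, Fintype.card_coe, Subtype.range_coe_subtype,
      Finset.setOfPred_mem] at this
    rw [Ne, this]
    exact hs
  exact measure_mono_null (convexHull_subset_affineSpan _)
    (Measure.addHaar_affineSubspace volume _ htop)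

/-- The triangles of a triangulation. -/
def triangles (K : Geometry.SimplicialComplex ℝ ℂ) : Set (Finset ℂ) := {s ∈ K.faces | s.card = 3}

namespace IsTriangulation

variable {Ω : Set ℂ} {K : Geometry.SimplicialComplex ℝ ℂ}

lemma finite_triangles (hK : IsTriangulation Ω K) : (triangles K).Finite :=
  hK.finite.subset fun _ h => h.1

lemma isClosed_convexHull (s : Finset ℂ) : IsClosed (convexHull ℝ (s : Set ℂ)) :=
  (s.finite_toSet.isCompact_convexHull (𝕜 := ℝ)).isClosed

/-- The triangles fill the closure of the domain. -/
lemma closure_subset (hK : IsTriangulation Ω K) (hΩ : IsOpen Ω) :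
    closure Ω ⊆ ⋃ s ∈ triangles K, convexHull ℝ (s : Set ℂ) := by
  have hcl : IsClosed (⋃ s ∈ triangles K, convexHull ℝ (s : Set ℂ)) :=
    hK.finite_triangles.isClosed_biUnion fun s _ => isClosed_convexHull s
  refine closure_minimal ?_ hcl
  -- Vertices and edges have measure zero, so what the triangles miss in `Ω` is an open null set,
  -- hence empty.
  have hnull : volume (Ω \ ⋃ s ∈ triangles K, convexHull ℝ (s : Set ℂ)) = 0 := by
    refine measure_mono_null (t := ⋃ s ∈ {s ∈ K.faces | s.card ≠ 3}, convexHull ℝ (s : Set ℂ)) ?_ ?_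
    · intro z hz
      have : z ∈ K.space := hK.space_eq ▸ subset_closure hz.1
      obtain ⟨s, hs, hzs⟩ := Geometry.SimplicialComplex.mem_space_iff.1 this
      have h3 : s.card ≠ 3 := fun h => hz.2 (mem_biUnion (show s ∈ triangles K from ⟨hs, h⟩) hzs)
      exact mem_biUnion (show s ∈ {s ∈ K.faces | s.card ≠ 3} from ⟨hs, h3⟩) hzs
    · rw [measure_biUnion_null_iff (hK.finite.subset fun _ h => h.1).countable]
      exact fun s hs => volume_convexHull_eq_zero hs.2 (K.indep hs.1)
  have := ((hΩ.sdiff hcl).measure_eq_zero_iff volume).1 hnull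
  exact sdiff_eq_empty.1 this

end IsTriangulation

lemma AffineMap.convex_eqOn (g g' : ℂ →ᵃ[ℝ] ℝ) : Convex ℝ {z | g z = g' z} := by
  have : {z | g z = g' z} = (g - g') ⁻¹' {0} := by
    ext z; simp [sub_eq_zero]
  rw [this]
  exact (convex_singleton 0).affine_preimage _

lemma AffineMap.exists_lipschitzWith (g : ℂ →ᵃ[ℝ] ℝ) : ∃ L : ℝ≥0, LipschitzWith L g := by
  let l : ℂ →L[ℝ] ℝ := LinearMap.toContinuousLinearMap g.linear
  refine ⟨‖l‖₊, LipschitzWith.of_dist_le_mul fun x y => ?_⟩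
  have h : g x - g y = l (x - y) := by
    simp [l, ← vsub_eq_sub]
  rw [dist_eq_norm, dist_eq_norm, h]
  exact l.le_opNorm _

/-- Interpolation of a Lipschitz function with compact support in `Ω` by finite elements. -/
lemma exists_interpolant {Ω : Set ℂ} (hΩ : IsOpen Ω) (hb : Bornology.IsBounded Ω) {φ : ℂ → ℝ}
    {L : ℝ≥0} (hφ : LipschitzWith L φ) (hc : HasCompactSupport φ) (hs : tsupport φ ⊆ Ω) :
    ∃ h₁ : ℝ, 0 < h₁ ∧ ∀ (K : Geometry.SimplicialComplex ℝ ℂ) (h : ℝ), IsTriangulation Ω K →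
      MeshSizeLE K h → h ≤ h₁ →
      ∃ u ∈ feSpace Ω K, ∀ᵐ z ∂volume.restrict Ω, |H01.val u z - φ z| ≤ L * h := by
  -- `h₁` is a margin around the support of `φ`: below this mesh size, a triangle meeting the
  -- complement of `Ω` has no vertex in the support.
  obtain ⟨h₁, h₁pos, hcth⟩ := hc.isCompact.exists_cthickening_subset_open hΩ hs
  refine ⟨h₁, h₁pos, fun K h hK hmesh hh => ?_⟩
  have hg : ∀ s : Finset ℂ, ∃ g : ℂ →ᵃ[ℝ] ℝ, s ∈ triangles K → ∀ v ∈ s, g v = φ v := by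
    intro s
    by_cases hsT : s ∈ triangles K
    · obtain ⟨g, hg⟩ := exists_affineMap_eq hsT.2 (K.indep hsT.1) φ
      exact ⟨g, fun _ => hg⟩
    · exact ⟨0, fun h => absurd h hsT⟩
  choose g hg using hg
  -- Triangles meet only in the hull of their common vertices, where both affine maps interpolate
  -- `φ`; this makes the piecewise definition consistent.
  have hagree : ∀ s ∈ triangles K, ∀ t ∈ triangles K, ∀ z ∈ convexHull ℝ (s : Set ℂ),
      z ∈ convexHull ℝ (t : Set ℂ) → g s z = g t z := by
    intro s hs t ht z hzs hzt
    have hz := K.inter_subset_convexHull hs.1 ht.1 ⟨hzs, hzt⟩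
    refine convexHull_min (t := {z | g s z = g t z}) (fun v hv => ?_)
      (AffineMap.convex_eqOn _ _) hz
    exact (hg s hs v hv.1).trans (hg t ht v hv.2).symm
  classical
  let f : ℂ → ℝ := fun z =>
    if hz : ∃ s ∈ triangles K, z ∈ convexHull ℝ (s : Set ℂ) then g hz.choose z else 0
  have hf : ∀ s ∈ triangles K, EqOn f (g s) (convexHull ℝ (s : Set ℂ)) := by
    intro s hs z hz
    have hex : ∃ s ∈ triangles K, z ∈ convexHull ℝ (s : Set ℂ) := ⟨s, hs, hz⟩
    simp only [f, dif_pos hex]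
    exact hagree _ hex.choose_spec.1 s hs z hex.choose_spec.2 hz
  have hdist : ∀ s ∈ triangles K, ∀ z ∈ convexHull ℝ (s : Set ℂ), ∀ v ∈ s, dist z v ≤ h := by
    intro s hs z hz v hv
    exact (Metric.dist_le_diam_of_mem
      (s.finite_toSet.isCompact_convexHull (𝕜 := ℝ)).isBounded hz
      (subset_convexHull ℝ _ hv)).trans (hmesh s hs.1 hs.2)
  have hzero : ∀ s ∈ triangles K, ∀ w ∈ convexHull ℝ (s : Set ℂ), w ∉ Ω →
      EqOn f 0 (convexHull ℝ (s : Set ℂ)) := by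
    intro s hs w hw hwΩ z hz
    rw [hf s hs hz]
    refine convexHull_min (t := {z | g s z = (0 : ℂ →ᵃ[ℝ] ℝ) z}) (fun v hv => ?_)
      (AffineMap.convex_eqOn _ _) hz
    refine (hg s hs v hv).trans (image_eq_zero_of_notMem_tsupport fun hv' => hwΩ (hcth ?_))
    exact Metric.mem_cthickening_of_dist_le w v h₁ _ hv' ((hdist s hs w hw v hv).trans hh)
  have hcov : ∀ z ∈ Ω, ∃ s ∈ triangles K, z ∈ convexHull ℝ (s : Set ℂ) := by
    intro z hz
    simpa using hK.closure_subset hΩ (subset_closure hz)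
  have hout : ∀ z, z ∉ Ω → f z = 0 := by
    intro z hz
    by_cases hex : ∃ s ∈ triangles K, z ∈ convexHull ℝ (s : Set ℂ)
    · obtain ⟨s, hs, hzs⟩ := hex
      exact hzero s hs z hzs hz hzs
    · simp only [f, dif_neg hex]
  have : Finite (triangles K) := hK.finite_triangles
  -- The complement of `Ω` joins the triangles as one more closed piece, on which `f` vanishes. The
  -- pieces then cover the plane and `f` is globally Lipschitz.
  let F : Option (triangles K) → Set ℂ := fun o => o.elim Ωᶜ fun s => convexHull ℝ (s.1 : Set ℂ)
  have hFcl : ∀ o, IsClosed (F o) := by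
    rintro (_ | s)
    · exact hΩ.isClosed_compl
    · exact IsTriangulation.isClosed_convexHull _
  have hFcov : ∀ z, ∃ o, z ∈ F o := by
    intro z
    by_cases hz : z ∈ Ω
    · obtain ⟨s, hs, hzs⟩ := hcov z hz
      exact ⟨some ⟨s, hs⟩, hzs⟩
    · exact ⟨none, hz⟩
  have hLip : ∀ o, ∃ M : ℝ≥0, LipschitzOnWith M f (F o) := by
    rintro (_ | s)
    · refine ⟨0, fun x hx y hy => ?_⟩
      rw [hout x hx, hout y hy]; simp
    · obtain ⟨M, hM⟩ := (g s.1).exists_lipschitzWith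
      refine ⟨M, fun x hx y hy => ?_⟩
      rw [hf s.1 s.2 hx, hf s.1 s.2 hy]
      exact hM x y
  choose M hM using hLip
  obtain ⟨M₀, hM₀⟩ := (finite_range M).bddAbove
  have hcont : Continuous f :=
    (locallyFinite_of_finite F).continuous (eq_univ_of_forall fun z => mem_iUnion.2 (hFcov z)) hFcl
      fun o => (hM o).continuousOn
  have hlip : LipschitzWith M₀ f := lipschitzWith_of_finite_closed_cover hcont hFcl hFcov
    fun o => (hM o).weaken (hM₀ ⟨o, rfl⟩)
  have hsupp : tsupport f ⊆ ⋃ s ∈ {s ∈ triangles K | convexHull ℝ (s : Set ℂ) ⊆ Ω},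
      convexHull ℝ (s : Set ℂ) := by
    refine closure_minimal (fun z hz => ?_)
      ((hK.finite_triangles.subset fun _ h => h.1).isClosed_biUnion fun s _ =>
        IsTriangulation.isClosed_convexHull s)
    have hzΩ : z ∈ Ω := by
      by_contra h
      exact hz (hout z h)
    obtain ⟨s, hs, hzs⟩ := hcov z hzΩ
    refine mem_biUnion (show s ∈ {s ∈ triangles K | convexHull ℝ (s : Set ℂ) ⊆ Ω} from
      ⟨hs, fun w hw => ?_⟩) hzs
    by_contra hwΩ
    exact hz (hzero s hs w hw hwΩ hzs)
  have hsΩ : tsupport f ⊆ Ω := hsupp.trans (iUnion₂_subset fun s hs => hs.2)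
  have hcf : HasCompactSupport f :=
    hb.isCompact_closure.of_isClosed_subset (isClosed_tsupport f) (hsΩ.trans subset_closure)
  obtain ⟨u, hu⟩ := exists_H01_of_lipschitz hΩ hb hlip hcf hsΩ
  refine ⟨u, ⟨f, ⟨hcont.continuousOn, fun z hz => hout z fun h => ?_, fun s hs hc =>
    ⟨g s, hf s ⟨hs, hc⟩⟩⟩, hu⟩, ?_⟩
  · rw [hΩ.frontier_eq] at hz
    exact hz.2 h
  · have hΩm : MeasurableSet Ω := hΩ.measurableSet
    filter_upwards [hu, ae_restrict_mem hΩm] with z hz hzΩ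
    obtain ⟨s, hs, hzs⟩ := hcov z hzΩ
    rw [hz, hf s hs hzs, ← Real.dist_eq, ← Metric.mem_closedBall]
    -- For fixed `z`, the bound on `|g s w - φ z|` is a convex condition in `w`, so it need only be
    -- checked at the vertices.
    refine convexHull_min (t := g s ⁻¹' Metric.closedBall (φ z) (L * h)) (fun v hv => ?_)
      ((convex_closedBall _ _).affine_preimage _) hzs
    rw [mem_preimage, hg s hs v hv, Metric.mem_closedBall, dist_comm]
    exact (hφ.dist_le_mul z v).trans (by gcongr; exact hdist s hs z hzs v hv)

/-! ### The singular functions: integrability, homogeneity and boundedness of `Δχ_k`. -/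

lemma measurable_polarAngle : Measurable polarAngle := by
  have : polarAngle = fun z => Int.fract (Complex.arg z / (2 * Real.pi)) * (2 * Real.pi) := by
    ext z
    rw [polarAngle, toIcoMod_eq_fract_mul]
  rw [this]
  exact (measurable_fract.comp (Complex.measurable_arg.div_const _)).mul_const _

lemma polarAngle_polar {r θ : ℝ} (hr : 0 < r) (h0 : 0 ≤ θ) (h1 : θ < 2 * Real.pi) :
    polarAngle (r * Complex.exp (θ * Complex.I)) = θ := by
  rw [polarAngle, Complex.arg_real_mul _ hr, Complex.arg_exp_mul_I, toIcoMod_eq_iff, zero_add]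
  refine ⟨⟨h0, h1⟩, -toIocDiv Real.two_pi_pos (-Real.pi) θ, ?_⟩
  have := self_sub_toIocDiv_zsmul Real.two_pi_pos (-Real.pi) θ
  rw [← this, neg_smul, sub_eq_add_neg]

lemma polarAngle_real_mul {r : ℝ} (hr : 0 < r) (z : ℂ) : polarAngle (r * z) = polarAngle z := by
  rw [polarAngle, Complex.arg_real_mul z hr, polarAngle]

namespace IsCutoff

variable {η : ℝ → ℝ} {τ R : ℝ}

lemma exists_bound (hη : IsCutoff η τ R) : ∃ M, 0 ≤ M ∧ ∀ r, 0 ≤ r → |η r| ≤ M := by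
  obtain ⟨M, hM⟩ := (isCompact_Icc (a := 0) (b := R)).exists_bound_of_continuousOn
    hη.smooth.continuous.continuousOn
  refine ⟨max M 0, le_max_right _ _, fun r hr => ?_⟩
  rcases le_or_gt r R with h | h
  · exact (hM r ⟨hr, h⟩).trans (le_max_left _ _)
  · simp [hη.eq_zero r h]

lemma measurable_chi (hη : IsCutoff η τ R) (ω : ℝ) (k : ℕ) : Measurable (chi ω η k) := by
  unfold chi
  refine ((hη.smooth.continuous.measurable.comp measurable_norm).mul
    (measurable_norm.pow_const _)).mul (Real.measurable_sin.comp ?_)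
  exact measurable_polarAngle.const_mul _

lemma exists_chi_bound (hη : IsCutoff η τ R) (ω : ℝ) :
    ∃ M, 0 ≤ M ∧ ∀ k z, |chi ω η k z| ≤ M * ‖z‖ ^ (-(k * Real.pi / ω)) := by
  obtain ⟨M, hM, h⟩ := hη.exists_bound
  refine ⟨M, hM, fun k z => ?_⟩
  have h1 : 0 ≤ ‖z‖ ^ (-(k * Real.pi / ω)) := by positivity
  rw [chi, abs_mul, abs_mul, abs_of_nonneg h1]
  calc _ ≤ M * ‖z‖ ^ (-(k * Real.pi / ω)) * 1 := by
        gcongr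
        · exact h _ (norm_nonneg z)
        · exact Real.abs_sin_le_one _
    _ = _ := mul_one _

/-- Integrability of the singular functions. -/
lemma memLp_chi (hη : IsCutoff η τ R) {Ω : Set ℂ} (hb : Bornology.IsBounded Ω) {ω : ℝ} {k : ℕ}
    {p : ℝ≥0} (hp : 0 < p) (hpk : k * Real.pi / ω * p < 2) :
    MemLp (chi ω η k) p (volume.restrict Ω) := by
  obtain ⟨M, hM, h⟩ := hη.exists_chi_bound ω
  obtain ⟨ρ, hρ⟩ := hb.subset_ball 0
  have hm := (hη.measurable_chi ω k).aestronglyMeasurable (μ := (volume : Measure ℂ))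
  refine MemLp.mono_measure (Measure.restrict_mono_set volume hρ) ?_
  rw [← integrable_norm_rpow_iff hm.restrict (by exact_mod_cast hp.ne') (by simp)]
  -- The power `|z|^(-sp)` is integrable near the origin of the plane since `sp < 2`.
  refine integrableOn_ball_of_norm_le_rpow (C := M ^ (p : ℝ)) (α := k * Real.pi / ω * p)
    (by simp) (by simpa using hpk) (Filter.Eventually.of_forall fun z => ?_) ?_
  · rw [Real.norm_of_nonneg (by positivity), ENNReal.coe_toReal, neg_mul_eq_neg_mul,
      Real.rpow_mul (norm_nonneg z), ← Real.mul_rpow hM (by positivity)]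
    exact Real.rpow_le_rpow (norm_nonneg _) (h k z) p.2
  · exact ((hη.measurable_chi ω k).norm.pow_const _).aestronglyMeasurable

/-- Where the cut-off equals 1, `χ_k` is homogeneous of degree `-kπ/ω`; the scaling argument rests
on this. -/
lemma chi_real_mul (hη : IsCutoff η τ R) {ω : ℝ} {k : ℕ} {ε : ℝ} (hε : 0 < ε) (hε1 : ε ≤ 1) {z : ℂ}
    (hz : ‖z‖ ≤ τ * R) : chi ω η k (ε * z) = ε ^ (-(k * Real.pi / ω)) * chi ω η k z := by
  have h1 : ‖(ε * z : ℂ)‖ = ε * ‖z‖ := by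
    rw [norm_mul, Complex.norm_real, Real.norm_of_nonneg hε.le]
  have h2 : ε * ‖z‖ ≤ τ * R := (mul_le_of_le_one_left (norm_nonneg z) hε1).trans hz
  rw [chi, chi, h1, hη.eq_one _ (by positivity) h2, hη.eq_one _ (norm_nonneg z) hz,
    polarAngle_real_mul hε, Real.mul_rpow hε.le (norm_nonneg z)]
  ring

end IsCutoff

/-- A harmonic branch of `r^{-s} sin(sθ)` near the closed sector of opening `ω`. -/
def singBranch (ω s : ℝ) (z : ℂ) : ℝ :=
  (-(Complex.exp (-(s * (ω / 2) : ℝ) * Complex.I) *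
    (z * Complex.exp (-(ω / 2 : ℝ) * Complex.I)) ^ (-s : ℂ))).im

lemma polar_rotate (r θ ω : ℝ) :
    (r * Complex.exp (θ * Complex.I)) * Complex.exp (-(ω / 2 : ℝ) * Complex.I) =
      r * Complex.exp ((θ - ω / 2 : ℝ) * Complex.I) := by
  rw [mul_assoc, ← Complex.exp_add]
  congr 2
  push_cast
  ring

/-- Rotation by `-ω/2` centres the sector on the positive real axis. As `ω < 2π`, even its closed
sides then avoid the branch cut. -/
lemma polar_rotate_mem_slitPlane {r θ ω : ℝ} (hω : ω < 2 * Real.pi) (hr : 0 < r) (h0 : 0 ≤ θ)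
    (h1 : θ ≤ ω) : (r * Complex.exp (θ * Complex.I)) * Complex.exp (-(ω / 2 : ℝ) * Complex.I) ∈
      Complex.slitPlane := by
  have hpi := Real.pi_pos
  rw [polar_rotate, Complex.mem_slitPlane_iff_arg, Complex.arg_real_mul _ hr,
    Complex.arg_exp_mul_I, (toIocMod_eq_self Real.two_pi_pos).2 ⟨by linarith, by linarith⟩]
  exact ⟨by linarith, mul_ne_zero (by exact_mod_cast hr.ne') (Complex.exp_ne_zero _)⟩

lemma singBranch_polar {r θ ω : ℝ} (s : ℝ) (hω : ω < 2 * Real.pi) (hr : 0 < r) (h0 : 0 ≤ θ)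
    (h1 : θ ≤ ω) : singBranch ω s (r * Complex.exp (θ * Complex.I)) =
      r ^ (-s) * Real.sin (s * θ) := by
  have h : (r * Complex.exp ((θ - ω / 2 : ℝ) * Complex.I) : ℂ) =
      Complex.exp (Real.log r + (θ - ω / 2 : ℝ) * Complex.I) := by
    rw [Complex.exp_add, ← Complex.ofReal_exp, Real.exp_log hr]
  have hlog : Complex.log (Complex.exp (Real.log r + (θ - ω / 2 : ℝ) * Complex.I)) =
      Real.log r + (θ - ω / 2 : ℝ) * Complex.I := by
    apply Complex.log_exp <;> simp <;> linarith
  have h2 : Complex.exp (-(s * (ω / 2) : ℝ) * Complex.I) *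
      Complex.exp ((Real.log r + (θ - ω / 2 : ℝ) * Complex.I) * (-s : ℂ)) =
      ((r ^ (-s) : ℝ) : ℂ) * Complex.exp ((-(s * θ) : ℝ) * Complex.I) := by
    rw [Real.rpow_def_of_pos hr, Complex.ofReal_exp, ← Complex.exp_add, ← Complex.exp_add]
    congr 1
    push_cast
    ring
  rw [singBranch, polar_rotate, h, Complex.cpow_def_of_ne_zero (Complex.exp_ne_zero _), hlog, h2,
    Complex.neg_im, Complex.im_ofReal_mul, Complex.exp_ofReal_mul_I_im, Real.sin_neg]
  ring

lemma analyticAt_branch {ω : ℝ} (s : ℝ) {z : ℂ}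
    (hz : z * Complex.exp (-(ω / 2 : ℝ) * Complex.I) ∈ Complex.slitPlane) :
    AnalyticAt ℂ (fun z : ℂ => -(Complex.exp (-(s * (ω / 2) : ℝ) * Complex.I) *
      (z * Complex.exp (-(ω / 2 : ℝ) * Complex.I)) ^ (-s : ℂ))) z := by
  refine (analyticAt_const.mul ?_).neg
  exact (analyticAt_id.mul analyticAt_const).cpow analyticAt_const hz

lemma contDiffAt_singBranch {ω : ℝ} (s : ℝ) {z : ℂ}
    (hz : z * Complex.exp (-(ω / 2 : ℝ) * Complex.I) ∈ Complex.slitPlane) :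
    ContDiffAt ℝ 2 (singBranch ω s) z :=
  (analyticAt_branch s hz).harmonicAt_im.1

lemma laplacian_singBranch {ω : ℝ} (s : ℝ) {z : ℂ}
    (hz : z * Complex.exp (-(ω / 2 : ℝ) * Complex.I) ∈ Complex.slitPlane) :
    Laplacian.laplacian (singBranch ω s) z = 0 :=
  (analyticAt_branch s hz).harmonicAt_im.2.eq_of_nhds

lemma chi_eq_singBranch {ω R : ℝ} (hω : ω < 2 * Real.pi) (η : ℝ → ℝ) (k : ℕ) {z : ℂ}
    (hz : z ∈ sector 0 0 ω R) :
    chi ω η k z = η ‖z‖ * singBranch ω (k * Real.pi / ω) z := by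
  obtain ⟨r, θ, hr, -, h0, h1, rfl⟩ := hz
  rw [zero_add, zero_add, singBranch_polar _ hω hr h0.le h1.le, chi,
    polarAngle_polar hr h0.le (h1.trans hω)]
  have : ‖(r * Complex.exp (θ * Complex.I) : ℂ)‖ = r := by
    rw [norm_mul, Complex.norm_exp_ofReal_mul_I, Complex.norm_real, Real.norm_of_nonneg hr.le,
      mul_one]
  rw [this]
  ring

lemma continuousAt_laplacian {F : ℂ → ℝ} {z : ℂ} (hF : ContDiffAt ℝ 2 F z) :
    ContinuousAt (Laplacian.laplacian F) z := by
  have h : ContinuousAt (iteratedFDeriv ℝ 2 F) z :=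
    (hF.iteratedFDeriv_right (m := 0) (i := 2) (by norm_num)).continuousAt
  rw [InnerProductSpace.laplacian_eq_iteratedFDeriv_complexPlane]
  exact ((ContinuousMultilinearMap.apply ℝ _ ℝ ![1, 1]).continuous.continuousAt.comp h).add
    ((ContinuousMultilinearMap.apply ℝ _ ℝ ![Complex.I, Complex.I]).continuous.continuousAt.comp h)

/-- The functions `Δχ_k` are bounded. -/
lemma exists_laplacian_chi_bound {Ω : Set ℂ} (hΩ : IsOpen Ω) {ω τ R : ℝ} {η : ℝ → ℝ}
    (hω : ω < 2 * Real.pi) (hτ : 0 < τ) (hR : 0 < R)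
    (hsector : Ω ∩ Metric.ball 0 R = sector 0 0 ω R) (hη : IsCutoff η τ R) (k : ℕ) :
    ∃ M : ℝ, 0 ≤ M ∧ ∀ᵐ z ∂volume.restrict Ω, |Laplacian.laplacian (chi ω η k) z| ≤ M := by
  set s := k * Real.pi / ω with hs
  let F : ℂ → ℝ := fun z => η ‖z‖ * singBranch ω s z
  -- Only the transition zone of `η` matters: `χ_k` is harmonic for `r < τR` and zero for `r > R`.
  -- The branch is smooth up to the sides of this compact piece, so its Laplacian is bounded there.
  let C : Set ℂ := (fun q : ℝ × ℝ => (q.1 * Complex.exp (q.2 * Complex.I) : ℂ)) ''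
    (Icc (τ * R) R ×ˢ Icc 0 ω)
  have hτR : 0 < τ * R := by positivity
  have hC : IsCompact C := (isCompact_Icc.prod isCompact_Icc).image (by fun_prop)
  have hslit : ∀ z ∈ C, z * Complex.exp (-(ω / 2 : ℝ) * Complex.I) ∈ Complex.slitPlane := by
    rintro _ ⟨⟨r, θ⟩, ⟨hr, hθ⟩, rfl⟩
    exact polar_rotate_mem_slitPlane hω (hτR.trans_le hr.1) hθ.1 hθ.2
  have hF : ContinuousOn (Laplacian.laplacian F) C := by
    intro z hz
    have hz0 : z ≠ 0 := by
      rintro rfl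
      simpa using Complex.slitPlane_ne_zero (hslit 0 hz)
    refine (continuousAt_laplacian ?_).continuousWithinAt
    exact ((hη.smooth.of_le (WithTop.coe_le_coe.2 le_top)).contDiffAt.comp z
      (contDiffAt_norm ℝ hz0)).mul (contDiffAt_singBranch s (hslit z hz))
  obtain ⟨M, hM⟩ := hC.exists_bound_of_continuousOn hF
  refine ⟨max M 0, le_max_right _ _, ?_⟩
  have hsph : ∀ᵐ z ∂volume.restrict Ω, z ∉ Metric.sphere (0 : ℂ) R :=
    ae_restrict_of_ae (measure_eq_zero_iff_ae_notMem.1 (Measure.addHaar_sphere volume 0 R))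
  filter_upwards [hsph, ae_restrict_mem hΩ.measurableSet] with z hz hzΩ
  have hopen : IsOpen (sector 0 0 ω R) := hsector ▸ hΩ.inter Metric.isOpen_ball
  rcases lt_or_ge ‖z‖ R with hzR | hzR
  · have hzs : z ∈ sector 0 0 ω R := hsector ▸ ⟨hzΩ, by simpa using hzR⟩
    have hzs' := hzs
    obtain ⟨r, θ, hr, hr', h0, h1, hrθ⟩ := hzs'
    rw [zero_add, zero_add] at hrθ
    have hnorm : ‖z‖ = r := by
      rw [hrθ, norm_mul, Complex.norm_exp_ofReal_mul_I, Complex.norm_real,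
        Real.norm_of_nonneg hr.le, mul_one]
    rcases lt_or_ge ‖z‖ (τ * R) with hzτ | hzτ
    · have heq : chi ω η k =ᶠ[𝓝 z] singBranch ω s := by
        filter_upwards [hopen.mem_nhds hzs,
          (isOpen_lt continuous_norm continuous_const).mem_nhds hzτ] with w hw hw'
        rw [chi_eq_singBranch hω η k hw, hη.eq_one _ (norm_nonneg w) (le_of_lt hw'), one_mul]
      rw [(InnerProductSpace.laplacian_congr_nhds heq).eq_of_nhds, laplacian_singBranch s, abs_zero]
      · exact le_max_right _ _
      · rw [hrθ]
        exact polar_rotate_mem_slitPlane hω hr h0.le h1.le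
    · have heq : chi ω η k =ᶠ[𝓝 z] F := by
        filter_upwards [hopen.mem_nhds hzs] with w hw
        exact chi_eq_singBranch hω η k hw
      rw [(InnerProductSpace.laplacian_congr_nhds heq).eq_of_nhds]
      refine (hM z ⟨(r, θ), ⟨⟨hnorm ▸ hzτ, hr'.le⟩, h0.le, h1.le⟩, hrθ.symm⟩).trans (le_max_left _ _)
  · have hzR' : R < ‖z‖ := lt_of_le_of_ne hzR fun h => hz (by simp [h])
    have heq : chi ω η k =ᶠ[𝓝 z] fun _ => 0 := by
      filter_upwards [(isOpen_lt continuous_const continuous_norm).mem_nhds hzR'] with w hw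
      rw [chi, hη.eq_zero _ hw, zero_mul, zero_mul]
    rw [(InnerProductSpace.laplacian_congr_nhds heq).eq_of_nhds, InnerProductSpace.laplacian_const]
    simp

/-! ### The scaling argument at the corner. -/

/-- A bounded open set which is a sector near the origin, with a cut-off function. -/
structure IsSectorNearZero (Ω : Set ℂ) (ω τ R : ℝ) (η : ℝ → ℝ) : Prop where
  isOpen : IsOpen Ω
  bounded : Bornology.IsBounded Ω
  angle_pos : 0 < ω
  angle_lt : ω < 2 * Real.pi
  tau_pos : 0 < τ
  tau_lt : τ < 1
  radius_pos : 0 < R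
  sector_eq : Ω ∩ Metric.ball 0 R = sector 0 0 ω R
  cutoff : IsCutoff η τ R

/-- The strict inequality `N < 2ω/π` gives this; the shift in `i + 1` matches the `- 1` in
`numSing`. -/
lemma exponent_lt_two {ω : ℝ} (hω : 0 < ω) (i : Fin (numSing ω)) :
    ((i + 1 : ℕ) : ℝ) * Real.pi / ω < 2 := by
  have h : (i : ℕ) + 1 < ⌈2 * ω / Real.pi⌉₊ := by
    have := i.2
    simp only [numSing] at this
    omega
  have h' := Nat.lt_ceil.1 h
  rw [lt_div_iff₀ Real.pi_pos] at h'
  rw [div_lt_iff₀ hω]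
  exact h'

/-- The value `1/2` is the threshold at which `r^(-s)` leaves `L⁴` near the origin. -/
lemma half_lt_exponent {ω : ℝ} (hω : 0 < ω) (hω' : ω < 2 * Real.pi) (i : ℕ) :
    1 / 2 < ((i + 1 : ℕ) : ℝ) * Real.pi / ω := by
  rw [lt_div_iff₀ hω]
  push_cast
  nlinarith [Real.pi_pos, mul_nonneg (i.cast_nonneg (α := ℝ)) Real.pi_pos.le]

/-- The linear combinations of the singular functions. -/
def chiSum (ω : ℝ) (η : ℝ → ℝ) (c : Fin (numSing ω) → ℝ) (z : ℂ) : ℝ :=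
  ∑ i, c i * chi ω η ((i : ℕ) + 1) z

namespace IsSectorNearZero

variable {Ω : Set ℂ} {ω τ R : ℝ} {η : ℝ → ℝ}

lemma isOpen_sector (h : IsSectorNearZero Ω ω τ R η) : IsOpen (sector 0 0 ω R) :=
  h.sector_eq ▸ h.isOpen.inter Metric.isOpen_ball

lemma smul_mem (h : IsSectorNearZero Ω ω τ R η) {z : ℂ} (hz : z ∈ Ω) (hzR : ‖z‖ < R) {ε : ℝ}
    (hε : 0 < ε) (hε1 : ε ≤ 1) : ε • z ∈ Ω := by
  have hzs : z ∈ sector 0 0 ω R := h.sector_eq ▸ ⟨hz, by simpa using hzR⟩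
  obtain ⟨r, θ, hr, hrR, h0, h1, rfl⟩ := hzs
  have : ε • (0 + r * Complex.exp (((0 + θ : ℝ) : ℂ) * Complex.I)) ∈ sector 0 0 ω R :=
    ⟨ε * r, θ, by positivity, (mul_le_of_le_one_left hr.le hε1).trans_lt hrR, h0, h1, by
      rw [Complex.real_smul]; push_cast; ring⟩
  rw [← h.sector_eq] at this
  exact this.1

lemma integrable_chi (h : IsSectorNearZero Ω ω τ R η) (i : Fin (numSing ω)) :
    Integrable (chi ω η ((i : ℕ) + 1)) (volume.restrict Ω) := by
  rw [← memLp_one_iff_integrable]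
  refine h.cutoff.memLp_chi (p := 1) h.bounded one_pos ?_
  simpa using exponent_lt_two h.angle_pos i

/-- A bump function detecting the singular function of index `k`. -/
lemma exists_bump (h : IsSectorNearZero Ω ω τ R η) (k : ℕ) :
    ∃ (z₀ : ℂ) (b : ContDiffBump z₀), ∀ z ∈ Metric.closedBall z₀ b.rOut,
      z ∈ Ω ∧ ‖z‖ < τ * R ∧ 0 < chi ω η (k + 1) z := by
  have hτR : 0 < τ * R := mul_pos h.tau_pos h.radius_pos
  have hτR' : τ * R < R := mul_lt_of_lt_one_left h.radius_pos h.tau_lt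
  have hpi := Real.pi_pos
  set ρ := τ * R / 2 with hρ
  -- On this ray the sine in `χ_(k+1)` has argument `π/2`.
  set θ := ω / (2 * (k + 1)) with hθ
  have hρ0 : 0 < ρ := by positivity
  have hθ0 : 0 < θ := div_pos h.angle_pos (by positivity)
  have hθω : θ < ω := by
    rw [hθ, div_lt_iff₀ (by positivity)]
    nlinarith [h.angle_pos, mul_nonneg h.angle_pos.le (k.cast_nonneg (α := ℝ))]
  set z₀ : ℂ := ρ * Complex.exp (θ * Complex.I) with hz₀
  have hnorm : ‖z₀‖ = ρ := by
    rw [hz₀, norm_mul, Complex.norm_exp_ofReal_mul_I, Complex.norm_real,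
      Real.norm_of_nonneg hρ0.le, mul_one]
  have hz₀s : z₀ ∈ sector 0 0 ω R := ⟨ρ, θ, hρ0, by linarith, hθ0, hθω, by simp [hz₀]⟩
  have hslit := polar_rotate_mem_slitPlane h.angle_lt hρ0 hθ0.le hθω.le
  have hcont : ContinuousAt (fun z => η ‖z‖ * singBranch ω ((k + 1 : ℕ) * Real.pi / ω) z) z₀ :=
    (h.cutoff.smooth.continuous.comp continuous_norm).continuousAt.mul
      (contDiffAt_singBranch _ hslit).continuousAt
  have hpos : 0 < η ‖z₀‖ * singBranch ω ((k + 1 : ℕ) * Real.pi / ω) z₀ := by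
    rw [h.cutoff.eq_one _ (norm_nonneg _) (by rw [hnorm]; linarith), one_mul, hz₀,
      singBranch_polar _ h.angle_lt hρ0 hθ0.le hθω.le]
    have : ((k + 1 : ℕ) : ℝ) * Real.pi / ω * θ = Real.pi / 2 := by
      have := h.angle_pos.ne'
      rw [hθ]; push_cast; field_simp
    rw [this, Real.sin_pi_div_two, mul_one]
    positivity
  have hev : ∀ᶠ z in 𝓝 z₀, z ∈ Ω ∧ ‖z‖ < τ * R ∧ 0 < chi ω η (k + 1) z := by
    filter_upwards [h.isOpen_sector.mem_nhds hz₀s, hcont.eventually (lt_mem_nhds hpos),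
      (isOpen_lt continuous_norm continuous_const).mem_nhds
        (show ‖z₀‖ < τ * R by rw [hnorm]; linarith)] with z h1 h2 h3
    refine ⟨(h.sector_eq.symm ▸ h1 : z ∈ Ω ∩ Metric.ball 0 R).1, h3, ?_⟩
    rwa [chi_eq_singBranch h.angle_lt η (k + 1) h1]
  obtain ⟨δ, hδ, hball⟩ := Metric.nhds_basis_closedBall.mem_iff.1 hev
  exact ⟨z₀, ⟨δ / 2, δ, half_pos hδ, half_lt_self hδ⟩, fun z hz => hball hz⟩

lemma isTest_bump (h : IsSectorNearZero Ω ω τ R η) {z₀ : ℂ} (b : ContDiffBump z₀)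
    (hb : ∀ z ∈ Metric.closedBall z₀ b.rOut, z ∈ Ω ∧ ‖z‖ < τ * R) {ε : ℝ} (hε : 0 < ε)
    (hε1 : ε ≤ 1) : IsTest Ω fun z => b (ε⁻¹ • z) := by
  refine ⟨b.contDiff.comp (contDiff_const_smul _),
    b.hasCompactSupport.comp_smul (inv_ne_zero hε.ne'),
    fun z hz => ?_⟩
  have hz' : ε⁻¹ • z ∈ Metric.closedBall z₀ b.rOut := by
    rw [← b.tsupport_eq]
    exact tsupport_comp_subset_preimage (b : ℂ → ℝ) (continuous_const_smul ε⁻¹) hz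
  obtain ⟨h1, h2⟩ := hb _ hz'
  have := h.smul_mem h1 (h2.trans (mul_lt_of_lt_one_left h.radius_pos h.tau_lt)) hε hε1
  rwa [smul_inv_smul₀ hε.ne'] at this

lemma integrable_chi_mul_bump (h : IsSectorNearZero Ω ω τ R η) {z₀ : ℂ} (b : ContDiffBump z₀)
    (i : Fin (numSing ω)) :
    Integrable (fun z => chi ω η ((i : ℕ) + 1) z * b z) (volume.restrict Ω) := by
  refine (h.integrable_chi i).mul_bdd (c := 1) b.continuous.aestronglyMeasurable
    (Filter.Eventually.of_forall fun z => ?_)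
  rw [Real.norm_of_nonneg b.nonneg]
  exact b.le_one

/-- The change of variables contributes the Jacobian `ε²`, and homogeneity on the support of the
bump contributes the other power of `ε`. -/
lemma integral_chiSum_bump (h : IsSectorNearZero Ω ω τ R η) {z₀ : ℂ} (b : ContDiffBump z₀)
    (hb : ∀ z ∈ Metric.closedBall z₀ b.rOut, z ∈ Ω ∧ ‖z‖ < τ * R) (c : Fin (numSing ω) → ℝ)
    {ε : ℝ} (hε : 0 < ε) (hε1 : ε ≤ 1) :
    ∫ z in Ω, chiSum ω η c z * b (ε⁻¹ • z) = ε ^ 2 * ∑ i, c i *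
      (ε ^ (-(((i + 1 : ℕ) : ℝ) * Real.pi / ω)) * ∫ z in Ω, chi ω η ((i : ℕ) + 1) z * b z) := by
  have hsupp : ∀ (f : ℂ → ℝ) z, z ∉ Ω → f z * b z = 0 := by
    intro f z hz
    rw [b.zero_of_le_dist, mul_zero]
    by_contra hd
    exact hz (hb z (Metric.mem_closedBall.2 (not_le.1 hd).le)).1
  have htest := h.isTest_bump b hb hε hε1
  rw [setIntegral_eq_integral_of_forall_compl_eq_zero
    (fun z hz => by rw [htest.eq_zero hz, mul_zero])]
  have h1 : ∀ z, chiSum ω η c z * b (ε⁻¹ • z) =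
      (fun w => chiSum ω η c (ε • w) * b w) (ε⁻¹ • z) := by
    intro z
    simp only [smul_inv_smul₀ hε.ne']
  rw [integral_congr_ae (Filter.Eventually.of_forall h1),
    Measure.integral_comp_smul volume (fun w => chiSum ω η c (ε • w) * b w)]
  have h2 : ∀ w, chiSum ω η c (ε • w) * b w = ∑ i, c i *
      (ε ^ (-(((i + 1 : ℕ) : ℝ) * Real.pi / ω)) * (chi ω η ((i : ℕ) + 1) w * b w)) := by
    intro w
    by_cases hw : w ∈ Metric.closedBall z₀ b.rOut
    · rw [chiSum, Finset.sum_mul]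
      refine Finset.sum_congr rfl fun i _ => ?_
      rw [Complex.real_smul, h.cutoff.chi_real_mul hε hε1 (hb w hw).2.le]
      ring
    · have : b w = 0 := b.zero_of_le_dist (not_le.1 fun h => hw (Metric.mem_closedBall.2 h)).le
      simp [this]
  simp_rw [h2]
  have hint : ∀ i : Fin (numSing ω), Integrable (fun w => chi ω η ((i : ℕ) + 1) w * b w) := by
    intro i
    rw [← integrableOn_iff_integrable_of_support_subset (s := Ω) fun z hz => by
      by_contra hz'
      exact hz (hsupp _ z hz')]
    exact h.integrable_chi_mul_bump b i
  rw [integral_finsetSum _ fun i _ => ((hint i).const_mul _).const_mul _]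
  simp only [Complex.finrank_real_complex, smul_eq_mul]
  rw [inv_pow, inv_inv, abs_of_nonneg (by positivity)]
  congr 1
  refine Finset.sum_congr rfl fun i _ => ?_
  rw [integral_const_mul, integral_const_mul,
    setIntegral_eq_integral_of_forall_compl_eq_zero (hsupp _)]

/-- No nontrivial combination of the singular functions acts on test functions like a function
of `L⁴`. -/
theorem eq_zero_of_bound (h : IsSectorNearZero Ω ω τ R η) {c : Fin (numSing ω) → ℝ} {C : ℝ}
    (hc : ∀ φ, IsTest Ω φ →
      |∫ z in Ω, chiSum ω η c z * φ z| ≤ C * (∫ z, |φ z| ^ (4 / 3 : ℝ)) ^ (3 / 4 : ℝ)) : c = 0 := by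
  classical
  by_contra hne
  have hS : (Finset.univ.filter fun i => c i ≠ 0).Nonempty := by
    obtain ⟨i, hi⟩ := Function.ne_iff.1 hne
    exact ⟨i, by simpa using hi⟩
  -- The largest index with a nonzero coefficient carries the strongest singularity, so it dominates
  -- as `ε → 0`.
  obtain ⟨k, hk, hmax⟩ := Finset.exists_max_image _ id hS
  simp only [Finset.mem_filter, Finset.mem_univ, true_and, id] at hk hmax
  obtain ⟨z₀, b, hb⟩ := h.exists_bump k
  have hb' : ∀ z ∈ Metric.closedBall z₀ b.rOut, z ∈ Ω ∧ ‖z‖ < τ * R :=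
    fun z hz => ⟨(hb z hz).1, (hb z hz).2.1⟩
  let s : Fin (numSing ω) → ℝ := fun i => ((i + 1 : ℕ) : ℝ) * Real.pi / ω
  let m : Fin (numSing ω) → ℝ := fun i => ∫ z in Ω, chi ω η ((i : ℕ) + 1) z * b z
  set B := ∫ z, |b z| ^ (4 / 3 : ℝ) with hB
  have hmk : 0 < m k := by
    refine (setIntegral_pos_iff_support_of_nonneg_ae (Filter.Eventually.of_forall fun z => ?_)
      (h.integrable_chi_mul_bump b k)).2 ?_
    · by_cases hz : z ∈ Metric.closedBall z₀ b.rOut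
      · exact mul_nonneg (hb z hz).2.2.le b.nonneg
      · have : b z = 0 := b.zero_of_le_dist (not_le.1 fun h => hz (Metric.mem_closedBall.2 h)).le
        simp [this]
    · refine (Metric.measure_ball_pos volume z₀ b.rOut_pos).trans_le (measure_mono fun z hz => ?_)
      have hz' := hb z (Metric.ball_subset_closedBall hz)
      exact ⟨(mul_pos hz'.2.2 (b.pos_of_mem_ball hz)).ne', hz'.1⟩
  have hs : 1 / 2 < s k := half_lt_exponent h.angle_pos h.angle_lt k
  -- The hypothesis for the scaled bump, multiplied by `ε^(s k - 2)`. On the left only the term `k`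
  -- survives in the limit; the right side tends to zero because `s k > 1/2`.
  have hle : ∀ ε : ℝ, 0 < ε → ε ≤ 1 →
      |∑ i, c i * (ε ^ (s k - s i) * m i)| ≤ C * B ^ (3 / 4 : ℝ) * ε ^ (s k - 1 / 2) := by
    intro ε hε hε1
    have h1 := hc _ (h.isTest_bump b hb' hε hε1)
    rw [h.integral_chiSum_bump b hb' c hε hε1] at h1
    have h2 : ∫ z, |b (ε⁻¹ • z)| ^ (4 / 3 : ℝ) = ε ^ 2 * B := by
      rw [Measure.integral_comp_smul volume (fun z => |b z| ^ (4 / 3 : ℝ))]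
      simp only [Complex.finrank_real_complex, smul_eq_mul]
      rw [inv_pow, inv_inv, abs_of_nonneg (by positivity)]
    have hB0 : 0 ≤ B := integral_nonneg fun z => by positivity
    have h3 : (ε ^ 2) ^ (3 / 4 : ℝ) = ε ^ (3 / 2 : ℝ) := by
      rw [← Real.rpow_natCast, ← Real.rpow_mul hε.le]; norm_num
    rw [h2, Real.mul_rpow (by positivity) hB0, h3] at h1
    have h4 : ∑ i, c i * (ε ^ (s k - s i) * m i) =
        ε ^ (s k - 2) * (ε ^ 2 * ∑ i, c i * (ε ^ (-s i) * m i)) := by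
      rw [← mul_assoc, ← Real.rpow_natCast, ← Real.rpow_add hε, Finset.mul_sum]
      refine Finset.sum_congr rfl fun i _ => ?_
      rw [sub_eq_add_neg, Real.rpow_add hε]
      norm_num
      ring
    have h5 : ε ^ (s k - 1 / 2) = ε ^ (s k - 2) * ε ^ (3 / 2 : ℝ) := by
      rw [← Real.rpow_add hε]; norm_num
      congr 1; ring
    have h6 : 0 ≤ ε ^ (s k - 2) := by positivity
    rw [h4, abs_mul, abs_of_nonneg h6, h5]
    calc _ ≤ ε ^ (s k - 2) * (C * (ε ^ (3 / 2 : ℝ) * B ^ (3 / 4 : ℝ))) := by gcongr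
      _ = _ := by ring
  have hlim1 : Filter.Tendsto (fun ε : ℝ => |∑ i, c i * (ε ^ (s k - s i) * m i)|) (𝓝[>] 0)
      (𝓝 |∑ i, if i = k then c k * m k else 0|) := by
    refine (tendsto_finsetSum _ fun i _ => ?_).abs
    rcases lt_trichotomy i k with hik | rfl | hik
    · rw [if_neg hik.ne]
      have hpos : 0 < s k - s i := by
        have : (i : ℝ) < k := by exact_mod_cast hik
        have : s i < s k := by
          simp only [s]
          have := h.angle_pos
          have := Real.pi_pos
          push_cast
          gcongr
        linarith
      have : Filter.Tendsto (fun ε : ℝ => ε ^ (s k - s i)) (𝓝[>] 0) (𝓝 0) := by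
        have := (Real.continuousAt_rpow_const 0 (s k - s i) (Or.inr hpos.le)).tendsto
        rw [Real.zero_rpow hpos.ne'] at this
        exact this.mono_left nhdsWithin_le_nhds
      simpa using (this.mul_const (m i)).const_mul (c i)
    · simp
    · rw [if_neg hik.ne']
      have : c i = 0 := by
        by_contra hi
        exact absurd (hmax i hi) (not_le.2 hik)
      simp [this]
  have hlim2 : Filter.Tendsto (fun ε : ℝ => C * B ^ (3 / 4 : ℝ) * ε ^ (s k - 1 / 2)) (𝓝[>] 0)
      (𝓝 0) := by
    have hpos : 0 < s k - 1 / 2 := by linarith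
    have := (Real.continuousAt_rpow_const 0 (s k - 1 / 2) (Or.inr hpos.le)).tendsto
    rw [Real.zero_rpow hpos.ne'] at this
    simpa using (this.mono_left nhdsWithin_le_nhds).const_mul (C * B ^ (3 / 4 : ℝ))
  have hfin := le_of_tendsto_of_tendsto hlim1 hlim2 (by
    filter_upwards [Ioc_mem_nhdsGT zero_lt_one] with ε hε
    exact hle ε hε.1 hε.2)
  rw [Finset.sum_ite_eq' Finset.univ k, if_pos (Finset.mem_univ k)] at hfin
  have := abs_nonpos_iff.1 hfin
  exact (mul_ne_zero hk hmk.ne') this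

end IsSectorNearZero

/-! ### Mesh-independent bounds and independence in `H⁻¹(Ω)`. -/

/-- Hölder with exponents `4/3` and `4`, combined with the embedding of `H¹₀(Ω)` in `L⁴(Ω)`. -/
lemma exists_test_pairing_bound {Ω : Set ℂ} (hb : Bornology.IsBounded Ω) :
    ∃ C : ℝ, 0 ≤ C ∧ ∀ φ, IsTest Ω φ → ∀ u : H01 Ω,
      |∫ z in Ω, H01.val u z * φ z| ≤
        C * ‖H01.grad u‖ * (∫ z, |φ z| ^ (4 / 3 : ℝ)) ^ (3 / 4 : ℝ) := by
  have hp : (1 : ℝ≥0) < 4 / 3 := by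
    rw [← NNReal.coe_lt_coe]; norm_num
  obtain ⟨C, hC0, hC⟩ := pairing_bound hb (NNReal.HolderConjugate.conjExponent hp)
  refine ⟨C, hC0, fun φ hφ u => ?_⟩
  have h1 := (hC φ (hφ.memLp _ _) u).2
  have hp0 : ((4 / 3 : ℝ≥0) : ℝ≥0∞) ≠ 0 := by
    exact_mod_cast (zero_lt_one.trans hp).ne'
  have h2 : (eLpNorm φ (4 / 3 : ℝ≥0) (volume.restrict Ω)).toReal ≤
      (∫ z, |φ z| ^ (4 / 3 : ℝ)) ^ (3 / 4 : ℝ) := by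
    have hm := hφ.memLp ((4 / 3 : ℝ≥0) : ℝ≥0∞) volume
    have h3 := hm.eLpNorm_eq_integral_rpow_norm hp0 ENNReal.coe_ne_top
    refine (ENNReal.toReal_mono hm.2.ne (eLpNorm_mono_measure _ Measure.restrict_le_self)).trans ?_
    rw [h3, ENNReal.toReal_ofReal (by positivity), ENNReal.coe_toReal]
    push_cast
    rw [inv_div]
    rfl
  simp_rw [mul_comm (H01.val u _)]
  calc _ ≤ ∫ z in Ω, |φ z * H01.val u z| := abs_integral_le_integral_abs
    _ ≤ C * (eLpNorm φ (4 / 3 : ℝ≥0) (volume.restrict Ω)).toReal * ‖H01.grad u‖ := h1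
    _ ≤ C * (∫ z, |φ z| ^ (4 / 3 : ℝ)) ^ (3 / 4 : ℝ) * ‖H01.grad u‖ := by gcongr
    _ = _ := by ring

lemma exists_integral_abs_bound {Ω : Set ℂ} (hb : Bornology.IsBounded Ω) :
    ∃ C : ℝ, 0 ≤ C ∧ ∀ u : H01 Ω, Integrable (H01.val u) (volume.restrict Ω) ∧
      ∫ z in Ω, |H01.val u z| ≤ C * ‖H01.grad u‖ := by
  have hfin : IsFiniteMeasure (volume.restrict Ω) := ⟨by simpa using hb.measure_lt_top⟩
  obtain ⟨C, hC0, hC⟩ := pairing_bound hb (p := 2) (q := 2) NNReal.HolderConjugate.two_two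
  have h := hC (fun _ => 1) (memLp_const 1)
  refine ⟨C * (eLpNorm (fun _ : ℂ => (1 : ℝ)) (2 : ℝ≥0) (volume.restrict Ω)).toReal, by positivity,
    fun u => ?_⟩
  simpa using h u

namespace IsSectorNearZero

variable {Ω : Set ℂ} {ω τ R : ℝ} {η : ℝ → ℝ}

/-- The finite element functions `ζ_i` are bounded uniformly with respect to the mesh. -/
lemma exists_zeta_bound (h : IsSectorNearZero Ω ω τ R η) :
    ∃ C : ℝ, 0 ≤ C ∧ ∀ (K : Geometry.SimplicialComplex ℝ ℂ) (ζ : Fin (numSing ω) → H01 Ω),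
      IsZeta K ω η ζ → ∀ i, ‖H01.grad (ζ i)‖ ≤ C := by
  obtain ⟨C₁, hC₁, h₁⟩ := exists_integral_abs_bound h.bounded
  choose M hM0 hM using exists_laplacian_chi_bound h.isOpen h.angle_lt h.tau_pos h.radius_pos
    h.sector_eq h.cutoff
  refine ⟨∑ i : Fin (numSing ω), M (i + 1) * C₁, Finset.sum_nonneg fun i _ =>
    mul_nonneg (hM0 _) hC₁, fun K ζ hζ i => ?_⟩
  have hle : ‖H01.grad (ζ i)‖ ≤ M (i + 1) * C₁ := by
    -- Energy estimate: the discrete equation is tested with `ζ i` itself.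
    have h2 : ‖H01.grad (ζ i)‖ ^ 2 ≤ M (i + 1) * C₁ * ‖H01.grad (ζ i)‖ := by
      calc ‖H01.grad (ζ i)‖ ^ 2 = dirichletForm (ζ i) (ζ i) := by
            rw [dirichletForm_eq_inner, real_inner_self_eq_norm_sq]
        _ = pairing (Laplacian.laplacian (chi ω η ((i : ℕ) + 1))) (ζ i) := (hζ i).2 _ (hζ i).1
        _ ≤ ∫ z in Ω, M (i + 1) * |H01.val (ζ i) z| := by
            refine (Real.le_norm_self _).trans
              (norm_integral_le_of_norm_le ((h₁ (ζ i)).1.abs.const_mul _) ?_)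
            filter_upwards [hM (i + 1)] with z hz
            rw [norm_mul]
            exact mul_le_mul_of_nonneg_right hz (norm_nonneg _)
        _ ≤ _ := by
            rw [integral_const_mul, mul_assoc]
            exact mul_le_mul_of_nonneg_left (h₁ (ζ i)).2 (hM0 _)
    by_contra hlt
    rw [not_le] at hlt
    have := mul_nonneg (hM0 (i + 1)) hC₁
    nlinarith
  exact hle.trans (Finset.single_le_sum (f := fun i : Fin (numSing ω) => M (i + 1) * C₁)
    (fun j _ => mul_nonneg (hM0 _) hC₁) (Finset.mem_univ i))

/-- The discrete dual singular functions belong to some `L^p(Ω)` with `p > 1`. -/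
lemma exists_memLp (h : IsSectorNearZero Ω ω τ R η) (i : Fin (numSing ω)) :
    ∃ p : ℝ≥0, 1 < p ∧ MemLp (chi ω η ((i : ℕ) + 1)) p (volume.restrict Ω) := by
  set s : ℝ := ((i + 1 : ℕ) : ℝ) * Real.pi / ω with hs
  have hs2 : s < 2 := exponent_lt_two h.angle_pos i
  have hs0 : 1 / 2 < s := half_lt_exponent h.angle_pos h.angle_lt i
  have h1 : 1 < 2 / s := by rw [lt_div_iff₀ (by linarith)]; linarith
  -- `r^(-s)` lies in `L^p` near the origin for `p < 2/s`, which leaves room above 1.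
  obtain ⟨p, hp1, hp2⟩ := exists_between h1
  lift p to ℝ≥0 using by linarith
  have hp1' : 1 < p := by exact_mod_cast hp1
  refine ⟨p, hp1', h.cutoff.memLp_chi h.bounded (zero_lt_one.trans hp1') ?_⟩
  rw [lt_div_iff₀ (by linarith)] at hp2
  linarith

lemma integrable_chi_mul (h : IsSectorNearZero Ω ω τ R η) (i : Fin (numSing ω)) (u : H01 Ω) :
    Integrable (fun z => chi ω η ((i : ℕ) + 1) z * H01.val u z) (volume.restrict Ω) := by
  obtain ⟨p, hp, hm⟩ := h.exists_memLp i
  obtain ⟨T, hT⟩ := exists_representsHneg1 h.bounded hp hm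
  exact (hT u).1

lemma integrable_val_mul (h : IsSectorNearZero Ω ω τ R η) (v u : H01 Ω) :
    Integrable (fun z => H01.val v z * H01.val u z) (volume.restrict Ω) := by
  obtain ⟨T, hT⟩ := exists_representsHneg1 h.bounded (p := 2) one_lt_two
    (H01.memLp_val h.bounded two_pos v)
  exact (hT u).1

lemma exists_represents_discreteXi (h : IsSectorNearZero Ω ω τ R η)
    (ζ : Fin (numSing ω) → H01 Ω) (i : Fin (numSing ω)) :
    ∃ T : Hneg1 Ω, RepresentsHneg1 (discreteXi ω η ζ i) T := by
  obtain ⟨p, hp, hm⟩ := h.exists_memLp i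
  exact exists_representsHneg1 h.bounded hp
    ((H01.memLp_val h.bounded (zero_lt_one.trans hp) (ζ i)).add hm)

lemma sum_pairing_eq (h : IsSectorNearZero Ω ω τ R η) (ζ : Fin (numSing ω) → H01 Ω)
    (c : Fin (numSing ω) → ℝ) (u : H01 Ω) :
    Integrable (fun z => chiSum ω η c z * H01.val u z) (volume.restrict Ω) ∧
    ∑ i, c i * pairing (discreteXi ω η ζ i) u =
      ∫ z in Ω, (chiSum ω η c z + H01.val (∑ i, c i • ζ i) z) * H01.val u z := by
  have hZ : (H01.val (∑ i, c i • ζ i)) =ᵐ[volume.restrict Ω]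
      fun z => ∑ i, c i * H01.val (ζ i) z := by
    have h1 : H01.val (∑ i, c i • ζ i) = ∑ i, c i • H01.val (ζ i) := by
      let V : H01 Ω →ₗ[ℝ] Lp ℝ 2 (volume.restrict Ω) := ⟨⟨H01.val, H01.val_add⟩, H01.val_smul⟩
      have : ∀ u, H01.val u = V u := fun _ => rfl
      simp only [this, map_sum, map_smul]
    rw [h1]
    refine (Lp.coeFn_finsetSum _ _).trans ?_
    filter_upwards [ae_all_iff.2 fun i => Lp.coeFn_smul (c i) (H01.val (ζ i))] with z hz
    simp [hz]
  have hchi : ∀ i, Integrable (fun z => c i * (chi ω η ((i : ℕ) + 1) z * H01.val u z))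
      (volume.restrict Ω) := fun i => (h.integrable_chi_mul i u).const_mul _
  have hval : ∀ i, Integrable (fun z => c i * (H01.val (ζ i) z * H01.val u z))
      (volume.restrict Ω) := fun i => (h.integrable_val_mul (ζ i) u).const_mul _
  constructor
  · have : (fun z => chiSum ω η c z * H01.val u z) =
        fun z => ∑ i, c i * (chi ω η ((i : ℕ) + 1) z * H01.val u z) := by
      ext z
      simp only [chiSum, Finset.sum_mul, mul_assoc]
    rw [this]
    exact integrable_finsetSum _ fun i _ => hchi i
  · have h2 : ∀ i, c i * pairing (discreteXi ω η ζ i) u = ∫ z in Ω,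
        (c i * (chi ω η ((i : ℕ) + 1) z * H01.val u z) + c i * (H01.val (ζ i) z * H01.val u z)) := by
      intro i
      rw [pairing, ← integral_const_mul]
      congr 1
      ext z
      rw [discreteXi]; ring
    simp_rw [h2]
    have hi : ∀ i, Integrable (fun z => c i * (chi ω η ((i : ℕ) + 1) z * H01.val u z) +
        c i * (H01.val (ζ i) z * H01.val u z)) (volume.restrict Ω) := fun i =>
      (hchi i).add (hval i)
    rw [← integral_finsetSum _ fun i _ => hi i]
    refine integral_congr_ae ?_
    filter_upwards [hZ] with z hz
    rw [hz, chiSum, ← Finset.sum_add_distrib, Finset.sum_mul]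
    refine Finset.sum_congr rfl fun i _ => ?_
    ring

lemma integrable_chiSum (h : IsSectorNearZero Ω ω τ R η) (c : Fin (numSing ω) → ℝ) :
    Integrable (chiSum ω η c) (volume.restrict Ω) :=
  integrable_finsetSum _ fun i _ => (h.integrable_chi i).const_mul _

/-- Isolates the singular part: up to the functional `∑ c_i ξ_i`, it acts on test functions as minus
an `H¹₀` function. -/
lemma pairing_test_eq (h : IsSectorNearZero Ω ω τ R η) (ζ : Fin (numSing ω) → H01 Ω)
    (c : Fin (numSing ω) → ℝ) {φ : ℂ → ℝ} (hφ : IsTest Ω φ) :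
    ∫ z in Ω, chiSum ω η c z * φ z = ∑ i, c i * pairing (discreteXi ω η ζ i) hφ.toH01 -
      ∫ z in Ω, H01.val (∑ i, c i • ζ i) z * φ z := by
  obtain ⟨h1, h2⟩ := h.sum_pairing_eq ζ c hφ.toH01
  have h3 := h.integrable_val_mul (∑ i, c i • ζ i) hφ.toH01
  have e1 : ∫ z in Ω, chiSum ω η c z * φ z =
      ∫ z in Ω, chiSum ω η c z * H01.val hφ.toH01 z := by
    refine integral_congr_ae ?_
    filter_upwards [hφ.val_toH01] with z hz
    rw [hz]
  have e2 : ∫ z in Ω, H01.val (∑ i, c i • ζ i) z * φ z =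
      ∫ z in Ω, H01.val (∑ i, c i • ζ i) z * H01.val hφ.toH01 z := by
    refine integral_congr_ae ?_
    filter_upwards [hφ.val_toH01] with z hz
    rw [hz]
  rw [h2, e1, e2]
  simp_rw [add_mul]
  rw [integral_add h1 h3, add_sub_cancel_right]

/-- The discrete dual singular functions are linearly independent in `H⁻¹(Ω)`. -/
theorem linearIndependent_discreteXi (h : IsSectorNearZero Ω ω τ R η)
    (ζ : Fin (numSing ω) → H01 Ω) {Ξ : Fin (numSing ω) → Hneg1 Ω}
    (hΞ : ∀ i, RepresentsHneg1 (discreteXi ω η ζ i) (Ξ i)) : LinearIndependent ℝ Ξ := by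
  obtain ⟨C, hC0, hC⟩ := exists_test_pairing_bound h.bounded
  rw [Fintype.linearIndependent_iff]
  intro c hc
  refine congrFun (h.eq_zero_of_bound (C := C * ‖H01.grad (∑ i, c i • ζ i)‖) fun φ hφ => ?_)
  have h0 : ∑ i, c i * pairing (discreteXi ω η ζ i) hφ.toH01 = 0 := by
    have := congrArg (fun T : Hneg1 Ω => T hφ.toH01) hc
    simpa [fun i => (hΞ i hφ.toH01).2] using this
  rw [h.pairing_test_eq ζ c hφ, h0, zero_sub, abs_neg]
  exact hC φ hφ _

/-! ### Fine meshes: the compactness argument. -/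

lemma norm_grad_sum_le {C : ℝ} {ζ : Fin (numSing ω) → H01 Ω} (hζ : ∀ i, ‖H01.grad (ζ i)‖ ≤ C)
    {d : Fin (numSing ω) → ℝ} (hd : ‖d‖ ≤ 1) :
    ‖H01.grad (∑ i, d i • ζ i)‖ ≤ numSing ω * C := by
  have h1 : H01.grad (∑ i, d i • ζ i) = ∑ i, d i • H01.grad (ζ i) := by
    have : ∀ u, H01.grad u = H01.gradₗ Ω u := fun _ => rfl
    simp only [this, map_sum, map_smul]
  rw [h1]
  refine (norm_sum_le _ _).trans ((Finset.sum_le_card_nsmul _ _ C fun i _ => ?_).trans (by simp))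
  rw [norm_smul]
  calc _ ≤ 1 * C := by
        gcongr
        · exact (norm_le_pi_norm d i).trans hd
        · exact hζ i
    _ = C := one_mul C

/-- A combination of the discrete dual singular functions that is orthogonal to the finite element
space nearly acts on test functions like a function of `L⁴`. -/
lemma exists_orthogonal_bound (h : IsSectorNearZero Ω ω τ R η) :
    ∃ C : ℝ, ∃ C' : ℝ, ∀ (K : Geometry.SimplicialComplex ℝ ℂ) (ζ : Fin (numSing ω) → H01 Ω),
      IsZeta K ω η ζ → ∀ d : Fin (numSing ω) → ℝ, ‖d‖ ≤ 1 →
      (∀ u ∈ feSpace Ω K, ∑ i, d i * pairing (discreteXi ω η ζ i) u = 0) →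
      ∀ φ, IsTest Ω φ → ∀ ε : ℝ, 0 ≤ ε → ∀ u ∈ feSpace Ω K,
      (∀ᵐ z ∂volume.restrict Ω, |H01.val u z - φ z| ≤ ε) →
      |∫ z in Ω, chiSum ω η d z * φ z| ≤
        ε * C + C' * (∫ z, |φ z| ^ (4 / 3 : ℝ)) ^ (3 / 4 : ℝ) := by
  obtain ⟨C₁, hC₁, h₁⟩ := exists_integral_abs_bound h.bounded
  obtain ⟨C₂, hC₂, h₂⟩ := h.exists_zeta_bound
  obtain ⟨C₃, hC₃, h₃⟩ := exists_test_pairing_bound h.bounded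
  -- The first constant bounds the `L¹` norm of `X_d + Z_d`, which is tested against the
  -- interpolation error. The second is the `L⁴` bound for `Z_d`. Neither depends on the mesh.
  refine ⟨(∑ i : Fin (numSing ω), ∫ z in Ω, |chi ω η ((i : ℕ) + 1) z|) + C₁ * (numSing ω * C₂),
    C₃ * (numSing ω * C₂), fun K ζ hζ d hd horth φ hφ ε hε u hu hclose => ?_⟩
  set Z := ∑ i, d i • ζ i with hZ
  have hgrad : ‖H01.grad Z‖ ≤ numSing ω * C₂ := norm_grad_sum_le (h₂ K ζ hζ) hd
  have hX : ∫ z in Ω, |chiSum ω η d z| ≤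
      ∑ i : Fin (numSing ω), ∫ z in Ω, |chi ω η ((i : ℕ) + 1) z| := by
    rw [← integral_finsetSum _ fun i _ => (h.integrable_chi i).abs]
    refine integral_mono (h.integrable_chiSum d).abs
      (integrable_finsetSum _ fun i _ => (h.integrable_chi i).abs) fun z => ?_
    refine (Finset.abs_sum_le_sum_abs _ _).trans (Finset.sum_le_sum fun i _ => ?_)
    rw [abs_mul]
    exact mul_le_of_le_one_left (abs_nonneg _) ((norm_le_pi_norm d i).trans hd)
  have hsum : |∑ i, d i * pairing (discreteXi ω η ζ i) hφ.toH01| ≤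
      ε * ((∑ i : Fin (numSing ω), ∫ z in Ω, |chi ω η ((i : ℕ) + 1) z|) +
        C₁ * (numSing ω * C₂)) := by
    have e1 := h.sum_pairing_eq ζ d hφ.toH01
    have e2 := h.sum_pairing_eq ζ d u
    -- Orthogonality allows subtracting the finite element function `u` from `φ`, leaving only the
    -- interpolation error.
    have e3 : ∑ i, d i * pairing (discreteXi ω η ζ i) hφ.toH01 =
        ∫ z in Ω, (chiSum ω η d z + H01.val Z z) * (H01.val hφ.toH01 z - H01.val u z) := by
      have i1 : Integrable (fun z => (chiSum ω η d z + H01.val Z z) * H01.val hφ.toH01 z)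
          (volume.restrict Ω) := by
        simp_rw [add_mul]
        exact e1.1.add (h.integrable_val_mul _ _)
      have i2 : Integrable (fun z => (chiSum ω η d z + H01.val Z z) * H01.val u z)
          (volume.restrict Ω) := by
        simp_rw [add_mul]
        exact e2.1.add (h.integrable_val_mul _ _)
      simp_rw [mul_sub]
      rw [integral_sub i1 i2, ← e1.2, ← e2.2, horth u hu, sub_zero]
    have iX := (h.integrable_chiSum d).abs
    have iZ := (h₁ Z).1.abs
    rw [e3, ← Real.norm_eq_abs]
    calc _ ≤ ∫ z in Ω, ε * (|chiSum ω η d z| + |H01.val Z z|) := by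
          refine norm_integral_le_of_norm_le ((iX.add iZ).const_mul ε) ?_
          filter_upwards [hclose, hφ.val_toH01] with z hz hz'
          rw [norm_mul, mul_comm, hz', norm_sub_rev]
          exact mul_le_mul hz (abs_add_le _ _) (norm_nonneg _) hε
      _ = ε * ((∫ z in Ω, |chiSum ω η d z|) + ∫ z in Ω, |H01.val Z z|) := by
          rw [integral_const_mul, integral_add iX iZ]
      _ ≤ _ := by
          gcongr
          exact (h₁ Z).2.trans (by gcongr)
  rw [h.pairing_test_eq ζ d hφ]
  refine (abs_sub _ _).trans (add_le_add hsum ((h₃ φ hφ Z).trans ?_))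
  gcongr

/-- On fine meshes, no nontrivial combination of the discrete dual singular functions is
orthogonal to the finite element space. -/
theorem exists_mesh_size (h : IsSectorNearZero Ω ω τ R η) :
    ∃ h₀ : ℝ, 0 < h₀ ∧ ∀ (K : Geometry.SimplicialComplex ℝ ℂ), IsTriangulation Ω K →
      MeshSizeLE K h₀ → ∀ ζ : Fin (numSing ω) → H01 Ω, IsZeta K ω η ζ →
      ∀ c : Fin (numSing ω) → ℝ,
      (∀ u ∈ feSpace Ω K, ∑ i, c i * pairing (discreteXi ω η ζ i) u = 0) → c = 0 := by
  by_contra! hcon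
  obtain ⟨C, C', hC⟩ := h.exists_orthogonal_bound
  have hseq : ∀ n : ℕ, ∃ K : Geometry.SimplicialComplex ℝ ℂ, IsTriangulation Ω K ∧
      MeshSizeLE K (1 / ((n : ℝ) + 1)) ∧ ∃ ζ : Fin (numSing ω) → H01 Ω, IsZeta K ω η ζ ∧
      ∃ d : Fin (numSing ω) → ℝ, ‖d‖ = 1 ∧
      ∀ u ∈ feSpace Ω K, ∑ i, d i * pairing (discreteXi ω η ζ i) u = 0 := by
    intro n
    obtain ⟨K, hK, hm, ζ, hζ, c, hc, hc0⟩ := hcon (1 / ((n : ℝ) + 1)) (by positivity)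
    refine ⟨K, hK, hm, ζ, hζ, ‖c‖⁻¹ • c, ?_, fun u hu => ?_⟩
    · rw [norm_smul, norm_inv, norm_norm, inv_mul_cancel₀ (norm_ne_zero_iff.2 hc0)]
    · simp only [Pi.smul_apply, smul_eq_mul, mul_assoc, ← Finset.mul_sum, hc u hu, mul_zero]
  choose K hK hm ζ hζ d hd horth using hseq
  -- The coefficient space does not change with the mesh, so unit coefficient vectors have a unit
  -- limit point, which is then shown to be zero.
  obtain ⟨a, ha, ns, hns, hlim⟩ := (isCompact_sphere (0 : Fin (numSing ω) → ℝ) 1).tendsto_subseq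
    (x := d) fun n => by simp [hd n]
  have ha0 : a = 0 := by
    refine h.eq_zero_of_bound (C := C') fun φ hφ => ?_
    obtain ⟨L, hL⟩ := hφ.smooth.lipschitzWith_of_hasCompactSupport hφ.compact (by simp)
    obtain ⟨h₁, h₁pos, hint⟩ := exists_interpolant h.isOpen h.bounded hL hφ.compact hφ.subset
    have hr : Filter.Tendsto (fun n => 1 / ((ns n : ℝ) + 1)) Filter.atTop (𝓝 0) :=
      (tendsto_one_div_add_atTop_nhds_zero_nat (𝕜 := ℝ)).comp hns.tendsto_atTop
    have hi : ∀ i : Fin (numSing ω),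
        Integrable (fun z => chi ω η ((i : ℕ) + 1) z * φ z) (volume.restrict Ω) := by
      intro i
      refine (h.integrable_chi_mul i hφ.toH01).congr ?_
      filter_upwards [hφ.val_toH01] with z hz
      rw [hz]
    have hexp : ∀ c : Fin (numSing ω) → ℝ, ∫ z in Ω, chiSum ω η c z * φ z =
        ∑ i, c i * ∫ z in Ω, chi ω η ((i : ℕ) + 1) z * φ z := by
      intro c
      simp_rw [← integral_const_mul]
      rw [← integral_finsetSum _ fun i _ => (hi i).const_mul _]
      simp only [chiSum, Finset.sum_mul, mul_assoc]
    have hl : Filter.Tendsto (fun n => |∫ z in Ω, chiSum ω η (d (ns n)) z * φ z|) Filter.atTop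
        (𝓝 |∫ z in Ω, chiSum ω η a z * φ z|) := by
      simp_rw [hexp]
      exact (tendsto_finsetSum _ fun i _ =>
        ((tendsto_pi_nhds.1 hlim i).mul_const _)).abs
    have hrhs : Filter.Tendsto (fun n => L * (1 / ((ns n : ℝ) + 1)) * C +
        C' * (∫ z, |φ z| ^ (4 / 3 : ℝ)) ^ (3 / 4 : ℝ)) Filter.atTop
        (𝓝 (C' * (∫ z, |φ z| ^ (4 / 3 : ℝ)) ^ (3 / 4 : ℝ))) := by
      simpa using ((hr.const_mul (L : ℝ)).mul_const C).add_const _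
    refine le_of_tendsto_of_tendsto hl hrhs ?_
    filter_upwards [hr.eventually (ge_mem_nhds h₁pos)] with n hn
    obtain ⟨u, hu, hclose⟩ := hint _ _ (hK (ns n)) (hm (ns n)) hn
    exact hC _ _ (hζ (ns n)) _ (hd _).le (horth (ns n)) φ hφ _ (by positivity) u hu hclose
  simp [ha0] at ha

end IsSectorNearZero

/-! ### The Gram system and the conclusion. -/

/-- A coefficient vector in the kernel of the Gram matrix gives a combination orthogonal to itself,
hence zero; injectivity is bijectivity for a square system. -/
lemma existsUnique_gram {ι E : Type*} [Fintype ι] [NormedAddCommGroup E] [InnerProductSpace ℝ E]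
    {g : ι → E} (hg : LinearIndependent ℝ g) (b : ι → ℝ) :
    ∃! c : ι → ℝ, ∀ j, ∑ i, c i * inner ℝ (g j) (g i) = b j := by
  let G : (ι → ℝ) →ₗ[ℝ] (ι → ℝ) :=
    { toFun := fun c j => ∑ i, c i * inner ℝ (g j) (g i)
      map_add' := fun c d => by ext j; simp [add_mul, Finset.sum_add_distrib]
      map_smul' := fun t c => by ext j; simp [Finset.mul_sum, mul_assoc] }
  have hinj : Function.Injective G := by
    rw [← LinearMap.ker_eq_bot, LinearMap.ker_eq_bot']
    intro c hc
    have h1 : ∀ j, inner ℝ (g j) (∑ i, c i • g i) = 0 := by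
      intro j
      rw [inner_sum]
      simp only [inner_smul_right]
      exact congrFun hc j
    have h2 : ∑ i, c i • g i = 0 := by
      rw [← inner_self_eq_zero (𝕜 := ℝ), sum_inner]
      exact Finset.sum_eq_zero fun j _ => by rw [real_inner_smul_left, h1, mul_zero]
    exact funext (Fintype.linearIndependent_iff.1 hg c h2)
  have hbij : Function.Bijective G := ⟨hinj, LinearMap.injective_iff_surjective.1 hinj⟩
  obtain ⟨c, hc, hu⟩ := hbij.existsUnique b
  exact ⟨c, fun j => congrFun hc j, fun d hd => hu d (funext hd)⟩
end

theorem mainTheorem5 {m : ℕ} (Ω : Set ℂ) (p : Fin (m + 3) → ℂ) (ω τ R : ℝ) (η : ℝ → ℝ)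
    (hΩ : IsCornerDomain Ω p ω) (hτ : 0 < τ ∧ τ < 1) (hR : 0 < R)
    (hsector : Ω ∩ Metric.ball 0 R = sector 0 0 ω R) (hη : IsCutoff η τ R) :
    (∀ K : Geometry.SimplicialComplex ℝ ℂ, IsTriangulation Ω K →
      ∀ ζ : Fin (numSing ω) → H01 Ω, IsZeta K ω η ζ →
        ∃ Ξ : Fin (numSing ω) → Hneg1 Ω,
          (∀ i, RepresentsHneg1 (discreteXi ω η ζ i) (Ξ i)) ∧ LinearIndependent ℝ Ξ) ∧
    (∀ κ : ℝ, ∃ h₀ : ℝ, 0 < h₀ ∧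
      ∀ K : Geometry.SimplicialComplex ℝ ℂ, IsTriangulation Ω K → ShapeRegular K κ →
        MeshSizeLE K h₀ →
      ∀ ζ σ : Fin (numSing ω) → H01 Ω, IsZeta K ω η ζ →
        (∀ i, IsFESolution K (discreteXi ω η ζ i) (σ i)) →
        LinearIndependent ℝ σ ∧
        LinearIndependent ℝ (fun i => H01.grad (σ i)) ∧
        ∀ v ∈ feSpace Ω K, ∃! c : Fin (numSing ω) → ℝ,
          ∀ j, ∑ i, c i * pairing (discreteXi ω η ζ j) (σ i) =
            pairing (discreteXi ω η ζ j) v) := by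
  have h : IsSectorNearZero Ω ω τ R η :=
    ⟨hΩ.polygonal.isOpen, hΩ.polygonal.isBounded, hΩ.corner_angle.1, hΩ.corner_angle.2.1, hτ.1,
      hτ.2, hR, hsector, hη⟩
  refine ⟨fun K _ ζ _ => ?_, fun κ => ?_⟩
  · choose Ξ hΞ using h.exists_represents_discreteXi ζ
    exact ⟨Ξ, hΞ, h.linearIndependent_discreteXi ζ hΞ⟩
  · obtain ⟨h₀, h₀pos, hh⟩ := h.exists_mesh_size
    refine ⟨h₀, h₀pos, fun K hK _ hm ζ σ hζ hσ => ?_⟩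
    have hgrad : LinearIndependent ℝ (fun i => H01.grad (σ i)) := by
      rw [Fintype.linearIndependent_iff]
      intro c hc
      refine congrFun (hh K hK hm ζ hζ c fun u hu => ?_)
      -- The defining equation of `σ i` turns a relation between gradients into orthogonality of `∑
      -- c_i ξ_i` to the finite element space.
      have : ∀ i, pairing (discreteXi ω η ζ i) u = inner ℝ (H01.grad (σ i)) (H01.grad u) :=
        fun i => ((hσ i).2 u hu).symm
      simp_rw [this, ← real_inner_smul_left]
      rw [← sum_inner, hc, inner_zero_left]
    refine ⟨LinearIndependent.of_comp (H01.gradₗ Ω) hgrad, hgrad, fun v _ => ?_⟩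
    -- Testing the equation of `σ j` with `σ i` shows that the system matrix is a Gram matrix.
    have : ∀ i j, pairing (discreteXi ω η ζ j) (σ i) =
        inner ℝ (H01.grad (σ j)) (H01.grad (σ i)) := fun i j => ((hσ j).2 _ (hσ i).1).symm
    simp_rw [this]
    exact existsUnique_gram hgrad _
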